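/- Setting. Let $M\ge 2$, $d\in\mathbb N$, $\sigma>0$, $\rho>0$. Fix a matrix $\mathbf B\in\mathbb R^{d\times d}$ with $I_d-\mathbf B$ invertible, a vector $b\in\mathbb R^d$, and a noise distribution of $(\varepsilon_X,\varepsilon_Y)$ on $\mathbb R^d\times\mathbb R$ with $E\|\varepsilon_X\|^2<\infty$, $E[\varepsilon_X]=0$, $E[\varepsilon_X\varepsilon_X^\top]=\Sigma=\frac{\sigma^2}{\rho}I_d$, $E[\varepsilon_Y]=0$, $E[\varepsilon_Y^2]=\sigma^2$, $E[\varepsilon_Y\varepsilon_X]=0$. For interventions $a^{(m)}=(a_X^{(m)},a_Y^{(m)})$, $m=1,\dots,M$, and $\tilde a=(\tilde a_X,\tilde a_Y)$ in $\mathbb R^{d}\times\mathbb R$, the $m$-th source distribution $\mathcal P^{(m)}$ is the law of the solution $(X,Y)$ of $$X=\mathbf BX+bY+a_X^{(m)}+\varepsilon_X,\qquad Y=a_Y^{(m)}+\varepsilon_Y,$$ and the target distribution $\tilde{\mathcal P}$ is the law of the solution with $\tilde a$ in place of $a^{(m)}$. Put $V=\mathrm{span}(a_X^{(2)}-a_X^{(1)},\dots,a_X^{(M)}-a_X^{(1)})$.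 Write $E_m,\tilde E$ for expectations under $\mathcal P^{(m)},\tilde{\mathcal P}$. The target risk of $f(x)=x^\top\beta+\beta_0$ is $\tilde R(f)=\tilde E(Y-f(X))^2$. For $\beta\in\mathbb R^d$, residual independence in environment $m$ means $E_m[(Y-E_m[Y])(Y-X^\top\beta)]=0$. Estimators. - RII: $(\beta_{\rm RII},\beta_0)$ minimizes $\frac1M\sum_{k}E_k(Y-X^\top\beta-\beta_0)^2$ subject to, for all $m\in\{2,\dots,M\}$, $E_m[Y-X^\top\beta]=E_1[Y-X^\top\beta]$ and residual independence in environment $m$. - CIP: $(\beta_{\rm CIP},\beta_0)$ minimizes the same objective subject to $E_m[X^\top\beta\mid Y]=E_1[X^\top\beta\mid Y]$ a.s. for all $m\in\{2,\dots,M\}$, meaning that one measurable function of $Y$ is a version of both conditional expectations. - RIIRMI$^{(m)}$ and CIRMI$^{(m)}$ minimize $E_m(Y-X^\top\beta-\beta_0)^2$ subject to residual independence in environment $m$ and $E_m[\beta^\top(X-(X^\top\gamma)\vartheta)]=\tilde E[\beta^\top(X-(X^\top\gamma)\vartheta)]$. For RIIRMI, $\gamma=\beta_{\rm RII}$ and $\vartheta=\dfrac{\frac1M\sum_kE_k[X(Y-E_kY)]}{\frac1M\sum_kE_k[(Y-E_kY)^2]}$.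 For CIRMI, $\gamma=\beta_{\rm CIP}$ and $\vartheta=\dfrac{\frac1M\sum_kE_k[X(Y-E_kY)]}{\frac1M\sum_kE_k[(X^\top\beta_{\rm CIP}-E_k[X^\top\beta_{\rm CIP}])(Y-E_kY)]}$. In the assertions about CIRMI only, assume in addition, if $a_Y^{(1)},\dots,a_Y^{(M)}$ are not all equal, that $E[\varepsilon_X\mid\varepsilon_Y]=0$ and that, for every $m$, the laws of $a_Y^{(m)}+\varepsilon_Y$ and $a_Y^{(1)}+\varepsilon_Y$ are not mutually singular. (1) Suppose $\tilde a_X-a_X^{(1)}\in V$ and $b\notin V$. Let the columns of $P_4$ be an orthonormal basis of $V$, and let $u^{(m)}=(a_X^{(m)}-\tilde a_X)/\|a_X^{(m)}-\tilde a_X\|_2$ ($u^{(m)}=0$ if $a_X^{(m)}=\tilde a_X$). Then the estimators RII and, for every $m\in\{1,\dots,M\}$, RIIRMI$^{(m)}$ and CIRMI$^{(m)}$ exist and are unique, and $$\tilde R(f_{\rm RII})=\frac{\sigma^2}{\rho\|b\|_2^2-\rho\|P_4^\top b\|_2^2},\qquad \tilde R(f^{(m)}_{\rm RIIRMI})=\tilde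 R(f^{(m)}_{\rm CIRMI})=\frac{\sigma^2}{\rho\|b\|_2^2-\rho\,(u^{(m)\top}b)^2}.$$ (2) Suppose $b\ne0$, $d\ge 6M$, the vectors $a_X^{(2)}-a_X^{(1)},\dots,a_X^{(M)}-a_X^{(1)},\xi$ are independent random vectors with law $\mathcal N(0,I_d)$ (with $\mathbf B$, $b$, the noise law, the $a_Y^{(m)}$ and $\tilde a_Y$ fixed), and $\tilde a_X-a_X^{(1)}$ is the orthogonal projection of $\xi$ onto $V$. Then for every $m\in\{1,\dots,M\}$ and every constant $0<c\le d/2$ there is an event of probability at least $$\bigl(1-2e^{-d/32}-2e^{-M/32}\bigr)_+\cdot\bigl(1-e^{-c/16}-2e^{-c/4}\bigr)_+$$ on which $\dim V=M-1$, the three estimators exist and are unique (for the given interventions), and $$\frac{\sigma^2}{\rho\left(1-\frac{M-1}{3d}\right)\|b\|_2^2}\le\tilde R(f_{\rm RII})\le\frac{\sigma^2}{\rho\left(1-\frac{3(M-1)}{d}\right)\|b\|_2^2},\qquad \tilde R(f^{(m)}_{\rm RIIRMI})=\tilde R(f^{(m)}_{\rm CIRMI})\le\frac{\sigma^2}{\rho\left(1-\frac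 cd\right)\|b\|_2^2}.$$ -/

import Mathlib

open MeasureTheory ProbabilityTheory

universe u

noncomputable section

namespace AnticausalDA

/-- Covariates live in `ℝ^d` with the Euclidean norm. -/
abbrev Vec (d : ℕ) : Type := EuclideanSpace ℝ (Fin d)

/-- `(X, Y)` solves the anticausal linear structural equations with coefficient matrix `B`,
coefficient vector `b`, mean-shift intervention `(aX, aY)` and noise `(εX, εY)`:
`X = B X + Y b + aX + εX` and `Y = aY + εY`. -/
def SolvesSCM {d : ℕ} (B : Matrix (Fin d) (Fin d) ℝ) (b : Vec d) (aX : Vec d) (aY : ℝ)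
    (ε z : Vec d × ℝ) : Prop :=
  z.1 = Matrix.toEuclideanLin B z.1 + z.2 • b + aX + ε.1 ∧ z.2 = aY + ε.2

/-- The solution `(X, Y)` of the structural equations as a function of the noise
(when `I - B` is invertible, see `solvesSCM_iff`). -/
def scmSolution {d : ℕ} (B : Matrix (Fin d) (Fin d) ℝ) (b : Vec d) (aX : Vec d) (aY : ℝ)
    (ε : Vec d × ℝ) : Vec d × ℝ :=
  (Matrix.toEuclideanLin (1 - B)⁻¹ ((aY + ε.2) • b + aX + ε.1), aY + ε.2)

theorem solvesSCM_iff {d : ℕ} (B : Matrix (Fin d) (Fin d) ℝ) (b : Vec d) (aX : Vec d) (aY : ℝ)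
    (hB : IsUnit (1 - B)) (ε z : Vec d × ℝ) :
    SolvesSCM B b aX aY ε z ↔ z = scmSolution B b aX aY ε := by
  obtain ⟨x, y⟩ := z
  have hd : IsUnit (1 - B).det := (Matrix.isUnit_iff_isUnit_det _).1 hB
  have h1 : ∀ w : Vec d, Matrix.toEuclideanLin (1 - B)⁻¹ (Matrix.toEuclideanLin (1 - B) w) = w := by
    intro w
    rw [Matrix.toLpLin_apply, Matrix.toLpLin_apply, Matrix.mulVec_mulVec,
      Matrix.nonsing_inv_mul _ hd, Matrix.one_mulVec]
  have h2 : ∀ w : Vec d, Matrix.toEuclideanLin (1 - B) (Matrix.toEuclideanLin (1 - B)⁻¹ w) = w := by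
    intro w
    rw [Matrix.toLpLin_apply, Matrix.toLpLin_apply, Matrix.mulVec_mulVec,
      Matrix.mul_nonsing_inv _ hd, Matrix.one_mulVec]
  have h3 : ∀ w : Vec d, Matrix.toEuclideanLin (1 - B) w = w - Matrix.toEuclideanLin B w := by
    intro w
    simp [Matrix.toLpLin_apply]
  simp only [SolvesSCM, scmSolution, Prod.mk.injEq]
  constructor
  · rintro ⟨hx, hy⟩
    refine ⟨?_, hy⟩
    rw [← hy, ← h1 x]
    congr 1
    rw [h3]
    nth_rewrite 1 [hx]
    abel
  · rintro ⟨hx, hy⟩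
    refine ⟨?_, hy⟩
    have h4 := congrArg (Matrix.toEuclideanLin (1 - B)) hx
    rw [h2, h3, ← hy, sub_eq_iff_eq_add] at h4
    rw [h4.trans (add_comm _ _)]
    rw [← h4.trans (add_comm _ _)]
    nth_rewrite 1 [h4]
    abel

theorem measurable_scmSolution {d : ℕ} (B : Matrix (Fin d) (Fin d) ℝ) (b : Vec d) (aX : Vec d)
    (aY : ℝ) : Measurable (scmSolution B b aX aY) := by
  have h : Continuous (Matrix.toEuclideanLin (1 - B)⁻¹ : Vec d →ₗ[ℝ] Vec d) :=
    LinearMap.continuous_of_finiteDimensional _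
  unfold scmSolution
  exact ((h.comp (by fun_prop)).prodMk (by fun_prop)).measurable

/-- The noise distribution on `ℝ^d × ℝ`: centred, square integrable, `E[εX εXᵀ] = S`,
`E[εY²] = σ²`, and `E[εY εX] = 0`. -/
structure IsNoise {d : ℕ} (noise : Measure (Vec d × ℝ)) (S : Matrix (Fin d) (Fin d) ℝ)
    (σ : ℝ) : Prop where
  prob : IsProbabilityMeasure noise
  memLp_X : MemLp (fun e : Vec d × ℝ => e.1) 2 noise
  memLp_Y : MemLp (fun e : Vec d × ℝ => e.2) 2 noise
  mean_X : ∫ e, e.1 ∂noise = 0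
  mean_Y : ∫ e, e.2 ∂noise = 0
  cov_X : ∀ i j, ∫ e, e.1 i * e.1 j ∂noise = S i j
  var_Y : ∫ e, e.2 ^ 2 ∂noise = σ ^ 2
  uncorrelated : ∫ e, e.2 • e.1 ∂noise = 0

/-- The data of the domain adaptation problem: the structural coefficients `B`, `b`, the common
noise distribution, the interventions `aX m`, `aY m` of the `M` source environments (the first
source environment has index `0`) and the interventions `aXt`, `aYt` of the target environment. -/
structure Model (d M : ℕ) where
  B : Matrix (Fin d) (Fin d) ℝ
  b : Vec d
  noise : Measure (Vec d × ℝ)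
  aX : Fin M → Vec d
  aY : Fin M → ℝ
  aXt : Vec d
  aYt : ℝ

namespace Model

variable {d M : ℕ}

/-- The distribution of `(X, Y)` in the `m`-th source environment. -/
def source (E : Model d M) (m : Fin M) : Measure (Vec d × ℝ) :=
  E.noise.map (scmSolution E.B E.b (E.aX m) (E.aY m))

/-- The distribution of `(X, Y)` in the target environment. -/
def target (E : Model d M) : Measure (Vec d × ℝ) :=
  E.noise.map (scmSolution E.B E.b E.aXt E.aYt)

end Model

/-- The mean squared error under `P` of the linear predictor `x ↦ xᵀβ + β₀`, `θ = (β, β₀)`. -/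
def mse {d : ℕ} (P : Measure (Vec d × ℝ)) (θ : Vec d × ℝ) : ℝ :=
  ∫ z, (z.2 - inner ℝ z.1 θ.1 - θ.2) ^ 2 ∂P

/-- Residual independence under `P`: `E[(Y - E[Y]) (Y - Xᵀβ)] = 0`. -/
def ResidualIndep {d : ℕ} (P : Measure (Vec d × ℝ)) (β : Vec d) : Prop :=
  ∫ z, (z.2 - ∫ w, w.2 ∂P) * (z.2 - inner ℝ z.1 β) ∂P = 0

/-- `θ` minimizes `f` over the feasible set `F`. -/
def IsArgmin {α : Type*} (f : α → ℝ) (F : Set α) (θ : α) : Prop :=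
  θ ∈ F ∧ ∀ η ∈ F, f θ ≤ f η

/-- `E_P[Xᵀβ | Y]` and `E_Q[Xᵀβ | Y]` agree almost surely: a single function `g` of the label is a
version of the conditional expectation under both distributions. -/
def SameCondMean {d : ℕ} (P Q : Measure (Vec d × ℝ)) (β : Vec d) : Prop :=
  ∃ g : ℝ → ℝ, Measurable g ∧
    (P[(fun z : Vec d × ℝ => inner ℝ z.1 β) | MeasurableSpace.comap Prod.snd inferInstance]
      =ᵐ[P] fun z => g z.2) ∧
    (Q[(fun z : Vec d × ℝ => inner ℝ z.1 β) | MeasurableSpace.comap Prod.snd inferInstance]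
      =ᵐ[Q] fun z => g z.2)

namespace Model

variable {d M : ℕ}

/-- The target population risk of the linear predictor `θ`. -/
def targetRisk (E : Model d M) (θ : Vec d × ℝ) : ℝ := mse E.target θ

/-- The average over the source environments of the mean squared errors. -/
def pooledRisk (E : Model d M) (θ : Vec d × ℝ) : ℝ :=
  (1 / (M : ℝ)) * ∑ k, mse (E.source k) θ

/-- The span of the differences of source interventions on the covariates. -/
def interventionSpan [NeZero M] (E : Model d M) : Submodule ℝ (Vec d) :=
  Submodule.span ℝ (Set.range fun m : Fin M => E.aX m - E.aX 0)

/-- The RII-mean estimator. -/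
def IsRII [NeZero M] (E : Model d M) : Vec d × ℝ → Prop :=
  IsArgmin E.pooledRisk
    {θ | ∀ m : Fin M, m ≠ 0 →
      ∫ z, (z.2 - inner ℝ z.1 θ.1) ∂(E.source m) = ∫ z, (z.2 - inner ℝ z.1 θ.1) ∂(E.source 0) ∧
      ResidualIndep (E.source m) θ.1}

/-- The CIP-mean estimator. -/
def IsCIP [NeZero M] (E : Model d M) : Vec d × ℝ → Prop :=
  IsArgmin E.pooledRisk
    {θ | ∀ m : Fin M, m ≠ 0 → SameCondMean (E.source m) (E.source 0) θ.1}

/-- `E[X (Y - E[Y])]` over the uniform mixture of the source environments, the label being centred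
within its environment. -/
def crossCov (E : Model d M) : Vec d :=
  (1 / (M : ℝ)) • ∑ k, ∫ z, (z.2 - ∫ w, w.2 ∂(E.source k)) • z.1 ∂(E.source k)

/-- `E[(Y - E[Y])²]` over the uniform mixture, with the same centring. -/
def labelVar (E : Model d M) : ℝ :=
  (1 / (M : ℝ)) * ∑ k, ∫ z, (z.2 - ∫ w, w.2 ∂(E.source k)) ^ 2 ∂(E.source k)

/-- `E[(Xᵀβ - E[Xᵀβ]) (Y - E[Y])]` over the uniform mixture, with the same centring. -/
def proxyCov (E : Model d M) (β : Vec d) : ℝ :=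
  (1 / (M : ℝ)) * ∑ k, ∫ z, (inner ℝ z.1 β - ∫ w, inner ℝ w.1 β ∂(E.source k)) *
    (z.2 - ∫ w, w.2 ∂(E.source k)) ∂(E.source k)

/-- The vector `ϑ` used by RIIRMI. -/
def varthetaRIIRMI (E : Model d M) : Vec d := (E.labelVar)⁻¹ • E.crossCov

/-- The vector `ϑ` used by CIRMI, for a given CIP coefficient vector. -/
def varthetaCIRMI (E : Model d M) (βCIP : Vec d) : Vec d := (E.proxyCov βCIP)⁻¹ • E.crossCov

/-- The residual matching problem with residual independence in the `m`-th source environment: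
minimize the `m`-th source risk subject to
`E_m[βᵀ(X - (Xᵀ proxy) ϑ)] = E_target[βᵀ(X - (Xᵀ proxy) ϑ)]` and residual independence. -/
def IsResidualMatching (E : Model d M) (m : Fin M) (proxy ϑ : Vec d) : Vec d × ℝ → Prop :=
  IsArgmin (mse (E.source m))
    {θ | ∫ z, inner ℝ θ.1 (z.1 - (inner ℝ z.1 proxy) • ϑ) ∂(E.source m) =
          ∫ z, inner ℝ θ.1 (z.1 - (inner ℝ z.1 proxy) • ϑ) ∂E.target ∧
        ResidualIndep (E.source m) θ.1}

/-- The RIIRMI-mean estimator based on the `m`-th source environment. -/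
def IsRIIRMI [NeZero M] (E : Model d M) (m : Fin M) (θ : Vec d × ℝ) : Prop :=
  ∃ θRII, E.IsRII θRII ∧ E.IsResidualMatching m θRII.1 E.varthetaRIIRMI θ

/-- The CIRMI-mean estimator based on the `m`-th source environment. -/
def IsCIRMI [NeZero M] (E : Model d M) (m : Fin M) (θ : Vec d × ℝ) : Prop :=
  ∃ θCIP, E.IsCIP θCIP ∧ E.IsResidualMatching m θCIP.1 (E.varthetaCIRMI θCIP.1) θ

/-- The estimator described by `Est` exists, is unique, and has target population risk `r`. -/
def HasTargetRisk (E : Model d M) (Est : Vec d × ℝ → Prop) (r : ℝ) : Prop :=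
  (∃! θ, Est θ) ∧ ∀ θ, Est θ → E.targetRisk θ = r

/-- The unit vector `u` in the direction of `aX m - aXt` (and `u = 0` if they are equal). -/
def u (E : Model d M) (m : Fin M) : Vec d := ‖E.aX m - E.aXt‖⁻¹ • (E.aX m - E.aXt)

end Model

/-- If the label interventions of the source environments are not all equal, then `E[εX | εY] = 0`
and the label distributions of the source environments overlap with that of the first one, so that
conditional expectations given the label can be compared across environments. -/
def LabelComparable {d M : ℕ} [NeZero M] (noise : Measure (Vec d × ℝ)) (aY : Fin M → ℝ) : Prop :=
  (∃ m, aY m ≠ aY 0) →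
    (noise[(fun e : Vec d × ℝ => e.1) | MeasurableSpace.comap Prod.snd inferInstance]
      =ᵐ[noise] 0) ∧
    ∀ m, ¬ (noise.map fun e => aY m + e.2).MutuallySingular (noise.map fun e => aY 0 + e.2)

end AnticausalDA

end

open AnticausalDA

/-!
In structural coordinates `w = ((I - B)⁻¹)ᵀ β` (`pull`), a solution of the structural equations
satisfies `Xᵀβ = Y bᵀw + aXᵀw + εXᵀw`. The mean squared error of `(β, β₀)` in an environment is then
`(aY (1 - bᵀw) - aXᵀw - β₀)² + (1 - bᵀw)² σ² + (σ² / ρ) ‖w‖²` (`mse_eq`), and residual independence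
is the equation `bᵀw = 1` (`residualIndep_iff`).

*Fixed interventions.* The constraints of RII say that `bᵀw = 1` and that `w` is orthogonal to the
intervention span `V`. The constraints of CIP say that `w` is orthogonal to `V`: the regressions of
`Xᵀβ` on the label in two environments differ by the constant `(aX m - aX 0)ᵀw`, and label laws that
are not mutually singular detect this constant (`sameCondMean_iff`). In both cases the proxy is
orthogonal to `V`, which contains `aX m - aXt`, and has a nonzero label effect, so that the matching
constraint, together with residual independence, says that `bᵀw = 1` and that `w` is orthogonal to
`aX m - aXt`. Thus RII, RIIRMI and CIRMI minimize `‖w‖` subject to `bᵀw = 1` and `w ⊥ K`, where `K`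
is `V` or the line of `aX m - aXt`. The minimizer is `w = p / ‖p‖²`, with `p` the component of `b`
orthogonal to `K` (`exists_argmin_of_constraint`), and the risk is
`(σ² / ρ) / ‖p‖² = σ² / (ρ ‖b‖² - ρ ‖P_K b‖²)`.

*Gaussian interventions.* It remains to control the share `‖P_K b‖² / ‖b‖²` of the fixed vector `b`
in the random subspaces `K`. The joint law of the shifts and of `ξ` is invariant under rotations,
and rotations move `K` along with them. By Fubini's theorem, `b` may therefore be replaced by a standard
Gaussian vector independent of `K` (`measure_le_of_rotation_invariant`), and the share of a Gaussian
vector in a fixed subspace obeys a Chernoff bound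
(`measureReal_stdGaussian_starProjection_le`). The resulting tail probabilities are small enough for
a union bound to give the product of the two factors (`chernoff_sum_le`).
-/

namespace AnticausalDA

/-! ### The structural parametrization and moments of the noise -/

/-- The structural coordinate of a coefficient vector `β`: the vector `w = ((I - B)⁻¹)ᵀ β`, so that
`Xᵀβ = (Y b + aX + εX)ᵀ w` for every solution of the structural equations. -/
noncomputable def pull {d : ℕ} (B : Matrix (Fin d) (Fin d) ℝ) : Vec d →ₗ[ℝ] Vec d :=
  LinearMap.adjoint (Matrix.toEuclideanLin (1 - B)⁻¹)

theorem pull_bijective {d : ℕ} {B : Matrix (Fin d) (Fin d) ℝ} (hB : IsUnit (1 - B)) :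
    Function.Bijective (pull B) := by
  have hd : IsUnit (1 - B).det := (Matrix.isUnit_iff_isUnit_det _).1 hB
  have h : ∀ w : Vec d,
      Matrix.toEuclideanLin (1 - B) (Matrix.toEuclideanLin (1 - B)⁻¹ w) = w := by
    intro w
    rw [Matrix.toLpLin_apply, Matrix.toLpLin_apply, Matrix.mulVec_mulVec,
      Matrix.mul_nonsing_inv _ hd, Matrix.one_mulVec]
  have hinj : Function.Injective (pull B) := by
    intro x y hxy
    refine ext_inner_left ℝ fun v => ?_
    have hs : Function.Surjective (Matrix.toEuclideanLin (1 - B)⁻¹ : Vec d →ₗ[ℝ] Vec d) :=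
      LinearMap.injective_iff_surjective.1 (Function.LeftInverse.injective h)
    obtain ⟨u, rfl⟩ := hs v
    rw [← LinearMap.adjoint_inner_right, ← LinearMap.adjoint_inner_right]
    exact congrArg (fun z => inner ℝ u z) hxy
  exact ⟨hinj, LinearMap.injective_iff_surjective.1 hinj⟩

theorem inner_scmSolution {d : ℕ} (B : Matrix (Fin d) (Fin d) ℝ) (b aX : Vec d) (aY : ℝ)
    (ε : Vec d × ℝ) (β : Vec d) :
    inner ℝ (scmSolution B b aX aY ε).1 β =
      (aY + ε.2) * inner ℝ b (pull B β) + inner ℝ aX (pull B β) + inner ℝ ε.1 (pull B β) := by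
  simp only [scmSolution, pull]
  rw [← LinearMap.adjoint_inner_right, inner_add_left, inner_add_left, real_inner_smul_left]

namespace IsNoise

variable {d : ℕ} {noise : Measure (Vec d × ℝ)} {s σ : ℝ}

theorem memLp_inner {S : Matrix (Fin d) (Fin d) ℝ} (h : IsNoise noise S σ) (w : Vec d) :
    MemLp (fun e : Vec d × ℝ => inner ℝ e.1 w) 2 noise :=
  h.memLp_X.inner_const w

theorem memLp_affine {S : Matrix (Fin d) (Fin d) ℝ} (h : IsNoise noise S σ) (c₀ c₁ : ℝ)
    (w : Vec d) :
    MemLp (fun e : Vec d × ℝ => c₀ + c₁ * e.2 + inner ℝ e.1 w) 2 noise := by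
  have := h.prob
  exact ((memLp_const c₀).add (h.memLp_Y.const_mul c₁)).add (h.memLp_inner w)

theorem integrable_affine {S : Matrix (Fin d) (Fin d) ℝ} (h : IsNoise noise S σ) (c₀ c₁ : ℝ)
    (w : Vec d) :
    Integrable (fun e : Vec d × ℝ => c₀ + c₁ * e.2 + inner ℝ e.1 w) noise := by
  have := h.prob
  exact (h.memLp_affine c₀ c₁ w).integrable (by norm_num)

theorem integral_inner_eq_zero {S : Matrix (Fin d) (Fin d) ℝ} (h : IsNoise noise S σ)
    (w : Vec d) : ∫ e, inner ℝ e.1 w ∂noise = 0 := by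
  have := h.prob
  have h1 := integral_inner (𝕜 := ℝ) (h.memLp_X.integrable (by norm_num)) w
  rw [h.mean_X, inner_zero_right] at h1
  rw [← h1]
  exact integral_congr_ae (.of_forall fun e => real_inner_comm (F := Vec d) w e.1)

theorem integral_label_mul_inner_eq_zero {S : Matrix (Fin d) (Fin d) ℝ} (h : IsNoise noise S σ)
    (w : Vec d) : ∫ e, e.2 * inner ℝ e.1 w ∂noise = 0 := by
  have h1 : Integrable (fun e : Vec d × ℝ => e.2 • e.1) noise :=
    memLp_one_iff_integrable.1 (MemLp.smul h.memLp_X h.memLp_Y)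
  have h2 := integral_inner (𝕜 := ℝ) h1 w
  rw [h.uncorrelated, inner_zero_right] at h2
  rw [← h2]
  refine integral_congr_ae (.of_forall fun e => ?_)
  simp only [real_inner_smul_right]
  rw [real_inner_comm]

theorem integral_inner_sq (h : IsNoise noise (s • (1 : Matrix (Fin d) (Fin d) ℝ)) σ)
    (w : Vec d) : ∫ e, (inner ℝ e.1 w) ^ 2 ∂noise = s * ‖w‖ ^ 2 := by
  have hc : ∀ i, MemLp (fun e : Vec d × ℝ => e.1 i) 2 noise := by
    intro i
    have := h.memLp_inner (EuclideanSpace.single i (1 : ℝ))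
    simpa [EuclideanSpace.inner_single_right] using this
  have hint : ∀ i j, Integrable (fun e : Vec d × ℝ => (e.1 i * e.1 j) * (w i * w j)) noise :=
    fun i j => ((hc i).integrable_mul (hc j)).mul_const _
  have h1 : ∀ e : Vec d × ℝ,
      (inner ℝ e.1 w) ^ 2 = ∑ i, ∑ j, (e.1 i * e.1 j) * (w i * w j) := by
    intro e
    rw [sq, PiLp.inner_apply, Finset.sum_mul_sum]
    refine Finset.sum_congr rfl fun i _ => Finset.sum_congr rfl fun j _ => ?_
    simp only [RCLike.inner_apply, conj_trivial]
    ring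
  simp_rw [h1]
  rw [integral_finsetSum _ fun i _ => integrable_finsetSum _ fun j _ => hint i j]
  simp_rw [integral_finsetSum _ fun j _ => hint _ j, integral_mul_const, h.cov_X]
  rw [EuclideanSpace.real_norm_sq_eq, Finset.mul_sum]
  refine Finset.sum_congr rfl fun i _ => ?_
  simp [Matrix.one_apply, sq]

theorem integral_affine {S : Matrix (Fin d) (Fin d) ℝ} (h : IsNoise noise S σ) (c₀ c₁ : ℝ)
    (w : Vec d) : ∫ e, (c₀ + c₁ * e.2 + inner ℝ e.1 w) ∂noise = c₀ := by
  have := h.prob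
  have hY : Integrable (fun e : Vec d × ℝ => e.2) noise := h.memLp_Y.integrable (by norm_num)
  have hX : Integrable (fun e : Vec d × ℝ => inner ℝ e.1 w) noise :=
    (h.memLp_inner w).integrable (by norm_num)
  rw [integral_add ((integrable_const c₀).fun_add (hY.const_mul c₁)) hX,
    integral_add (integrable_const _) (hY.const_mul _), integral_const_mul, h.mean_Y,
    h.integral_inner_eq_zero]
  simp

theorem integral_label_mul_affine {S : Matrix (Fin d) (Fin d) ℝ} (h : IsNoise noise S σ)
    (c₀ c₁ : ℝ) (w : Vec d) :
    ∫ e, e.2 * (c₀ + c₁ * e.2 + inner ℝ e.1 w) ∂noise = c₁ * σ ^ 2 := by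
  have := h.prob
  have hY : Integrable (fun e : Vec d × ℝ => e.2) noise := h.memLp_Y.integrable (by norm_num)
  have hYY : Integrable (fun e : Vec d × ℝ => e.2 ^ 2) noise := h.memLp_Y.integrable_sq
  have hYX : Integrable (fun e : Vec d × ℝ => e.2 * inner ℝ e.1 w) noise :=
    h.memLp_Y.integrable_mul (h.memLp_inner w)
  have h1 : ∀ e : Vec d × ℝ, e.2 * (c₀ + c₁ * e.2 + inner ℝ e.1 w) =
      c₀ * e.2 + c₁ * e.2 ^ 2 + e.2 * inner ℝ e.1 w := fun e => by ring
  simp_rw [h1]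
  rw [integral_add ((hY.const_mul c₀).fun_add (hYY.const_mul c₁)) hYX,
    integral_add (hY.const_mul _) (hYY.const_mul _), integral_const_mul, integral_const_mul,
    h.mean_Y, h.var_Y, h.integral_label_mul_inner_eq_zero]
  simp

theorem integral_affine_sq (h : IsNoise noise (s • (1 : Matrix (Fin d) (Fin d) ℝ)) σ)
    (c₀ c₁ : ℝ) (w : Vec d) :
    ∫ e, (c₀ + c₁ * e.2 + inner ℝ e.1 w) ^ 2 ∂noise = c₀ ^ 2 + c₁ ^ 2 * σ ^ 2 + s * ‖w‖ ^ 2 := by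
  have := h.prob
  have hA : Integrable (fun e : Vec d × ℝ => c₀ + c₁ * e.2 + inner ℝ e.1 w) noise :=
    h.integrable_affine c₀ c₁ w
  have hYA : Integrable (fun e : Vec d × ℝ => e.2 * (c₀ + c₁ * e.2 + inner ℝ e.1 w)) noise :=
    h.memLp_Y.integrable_mul (h.memLp_affine c₀ c₁ w)
  have hX : Integrable (fun e : Vec d × ℝ => inner ℝ e.1 w) noise :=
    (h.memLp_inner w).integrable (by norm_num)
  have hYX : Integrable (fun e : Vec d × ℝ => e.2 * inner ℝ e.1 w) noise :=
    h.memLp_Y.integrable_mul (h.memLp_inner w)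
  have hXX : Integrable (fun e : Vec d × ℝ => (inner ℝ e.1 w) ^ 2) noise :=
    (h.memLp_inner w).integrable_sq
  have h1 : ∀ e : Vec d × ℝ, (c₀ + c₁ * e.2 + inner ℝ e.1 w) ^ 2 =
      c₀ * (c₀ + c₁ * e.2 + inner ℝ e.1 w) + c₁ * (e.2 * (c₀ + c₁ * e.2 + inner ℝ e.1 w)) +
        (c₀ * inner ℝ e.1 w + c₁ * (e.2 * inner ℝ e.1 w) + (inner ℝ e.1 w) ^ 2) :=
    fun e => by ring
  simp_rw [h1]
  have i1 := (hA.const_mul c₀).fun_add (hYA.const_mul c₁)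
  have i2 := (hX.const_mul c₀).fun_add (hYX.const_mul c₁)
  rw [integral_add i1 (i2.fun_add hXX), integral_add (hA.const_mul c₀) (hYA.const_mul c₁),
    integral_add i2 hXX, integral_add (hX.const_mul c₀) (hYX.const_mul c₁)]
  simp only [integral_const_mul]
  rw [h.integral_affine, h.integral_label_mul_affine, h.integral_inner_eq_zero,
    h.integral_label_mul_inner_eq_zero, h.integral_inner_sq]
  ring

end IsNoise

/-! ### Moments of an environment -/

section Environment

variable {d : ℕ} {noise : Measure (Vec d × ℝ)} {S : Matrix (Fin d) (Fin d) ℝ} {s σ : ℝ}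

theorem integral_map_scmSolution {F : Type*} [NormedAddCommGroup F] [NormedSpace ℝ F]
    (B : Matrix (Fin d) (Fin d) ℝ) (b aX : Vec d) (aY : ℝ) {f : Vec d × ℝ → F}
    (hf : Continuous f) [SecondCountableTopology F] [MeasurableSpace F] [BorelSpace F] :
    ∫ z, f z ∂(noise.map (scmSolution B b aX aY)) = ∫ e, f (scmSolution B b aX aY e) ∂noise :=
  integral_map (measurable_scmSolution B b aX aY).aemeasurable hf.aestronglyMeasurable

theorem integral_label (h : IsNoise noise S σ) (B : Matrix (Fin d) (Fin d) ℝ) (b aX : Vec d)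
    (aY : ℝ) : ∫ z, z.2 ∂(noise.map (scmSolution B b aX aY)) = aY := by
  rw [integral_map_scmSolution B b aX aY (by fun_prop)]
  simpa [scmSolution] using h.integral_affine aY 1 0

theorem integral_inner_covariate (h : IsNoise noise S σ) (B : Matrix (Fin d) (Fin d) ℝ)
    (b aX : Vec d) (aY : ℝ) (β : Vec d) :
    ∫ z, inner ℝ z.1 β ∂(noise.map (scmSolution B b aX aY)) =
      aY * inner ℝ b (pull B β) + inner ℝ aX (pull B β) := by
  rw [integral_map_scmSolution B b aX aY (by fun_prop)]
  rw [← h.integral_affine (aY * inner ℝ b (pull B β) + inner ℝ aX (pull B β))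
    (inner ℝ b (pull B β)) (pull B β)]
  refine integral_congr_ae (.of_forall fun e => ?_)
  simp only [inner_scmSolution]
  ring

theorem integrable_inner_covariate (h : IsNoise noise S σ) (B : Matrix (Fin d) (Fin d) ℝ)
    (b aX : Vec d) (aY : ℝ) (β : Vec d) :
    Integrable (fun z : Vec d × ℝ => inner ℝ z.1 β) (noise.map (scmSolution B b aX aY)) := by
  rw [integrable_map_measure (Continuous.aestronglyMeasurable (by fun_prop))
    (measurable_scmSolution B b aX aY).aemeasurable]
  refine (h.integrable_affine (aY * inner ℝ b (pull B β) + inner ℝ aX (pull B β))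
    (inner ℝ b (pull B β)) (pull B β)).congr (.of_forall fun e => ?_)
  simp only [Function.comp_apply, inner_scmSolution]
  ring

theorem integral_residual (h : IsNoise noise S σ) (B : Matrix (Fin d) (Fin d) ℝ) (b aX : Vec d)
    (aY : ℝ) (β : Vec d) :
    ∫ z, (z.2 - inner ℝ z.1 β) ∂(noise.map (scmSolution B b aX aY)) =
      aY * (1 - inner ℝ b (pull B β)) - inner ℝ aX (pull B β) := by
  rw [integral_map_scmSolution B b aX aY (by fun_prop)]
  rw [← h.integral_affine (aY * (1 - inner ℝ b (pull B β)) - inner ℝ aX (pull B β))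
    (1 - inner ℝ b (pull B β)) (-pull B β)]
  refine integral_congr_ae (.of_forall fun e => ?_)
  simp only [inner_scmSolution, inner_neg_right]
  simp only [scmSolution]
  ring

theorem mse_eq (h : IsNoise noise (s • (1 : Matrix (Fin d) (Fin d) ℝ)) σ)
    (B : Matrix (Fin d) (Fin d) ℝ) (b aX : Vec d) (aY : ℝ) (θ : Vec d × ℝ) :
    mse (noise.map (scmSolution B b aX aY)) θ =
      (aY * (1 - inner ℝ b (pull B θ.1)) - inner ℝ aX (pull B θ.1) - θ.2) ^ 2 +
        (1 - inner ℝ b (pull B θ.1)) ^ 2 * σ ^ 2 + s * ‖pull B θ.1‖ ^ 2 := by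
  rw [mse, integral_map_scmSolution B b aX aY (by fun_prop), ← norm_neg (pull B θ.1),
    ← h.integral_affine_sq]
  refine integral_congr_ae (.of_forall fun e => ?_)
  simp only [inner_scmSolution, inner_neg_right]
  simp only [scmSolution]
  ring

/-- Residual independence constrains the label effect only: it says `bᵀw = 1`. -/
theorem residualIndep_iff (h : IsNoise noise S σ) (hσ : 0 < σ) (B : Matrix (Fin d) (Fin d) ℝ)
    (b aX : Vec d) (aY : ℝ) (β : Vec d) :
    ResidualIndep (noise.map (scmSolution B b aX aY)) β ↔ inner ℝ b (pull B β) = 1 := by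
  have h1 : ∫ z, (z.2 - aY) * (z.2 - inner ℝ z.1 β) ∂(noise.map (scmSolution B b aX aY)) =
      (1 - inner ℝ b (pull B β)) * σ ^ 2 := by
    rw [integral_map_scmSolution B b aX aY (by fun_prop)]
    rw [← h.integral_label_mul_affine (aY * (1 - inner ℝ b (pull B β)) - inner ℝ aX (pull B β))
      (1 - inner ℝ b (pull B β)) (-pull B β)]
    refine integral_congr_ae (.of_forall fun e => ?_)
    simp only [inner_scmSolution, inner_neg_right]
    simp only [scmSolution]
    ring
  rw [ResidualIndep, integral_label h, h1, mul_eq_zero, sub_eq_zero]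
  simp only [hσ.ne', ne_eq, OfNat.ofNat_ne_zero, not_false_eq_true,
    pow_eq_zero_iff, or_false]
  exact eq_comm

theorem integral_label_smul_covariate (h : IsNoise noise S σ) (B : Matrix (Fin d) (Fin d) ℝ)
    (b aX : Vec d) (aY : ℝ) :
    ∫ z, (z.2 - aY) • z.1 ∂(noise.map (scmSolution B b aX aY)) =
      σ ^ 2 • Matrix.toEuclideanLin (1 - B)⁻¹ b := by
  have := h.prob
  have hA : Continuous (Matrix.toEuclideanLin (1 - B)⁻¹ : Vec d →ₗ[ℝ] Vec d) :=
    LinearMap.continuous_of_finiteDimensional _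
  have hL : MemLp (fun e : Vec d × ℝ => (aY + e.2) • b + aX + e.1) 2 noise := by
    have h1 : MemLp (fun e : Vec d × ℝ => (aY + e.2) • b) 2 noise :=
      MemLp.smul (r := 2) (p := 2) (memLp_top_const b) ((memLp_const aY).add h.memLp_Y)
    exact (h1.add (memLp_const aX)).add h.memLp_X
  have hZ : MemLp (fun e : Vec d × ℝ => (scmSolution B b aX aY e).1) 2 noise :=
    (Matrix.toEuclideanLin (1 - B)⁻¹ : Vec d →ₗ[ℝ] Vec d).toContinuousLinearMap.comp_memLp' hL
  have hint : Integrable (fun e : Vec d × ℝ => e.2 • (scmSolution B b aX aY e).1) noise :=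
    memLp_one_iff_integrable.1 (MemLp.smul hZ h.memLp_Y)
  rw [integral_map_scmSolution B b aX aY (by fun_prop)]
  refine ext_inner_left ℝ fun v => ?_
  have h2 : ∀ e : Vec d × ℝ, ((scmSolution B b aX aY e).2 - aY) • (scmSolution B b aX aY e).1 =
      e.2 • (scmSolution B b aX aY e).1 := fun e => by simp [scmSolution]
  simp_rw [h2]
  rw [← integral_inner (𝕜 := ℝ) hint, real_inner_smul_right, ← LinearMap.adjoint_inner_left]
  change _ = σ ^ 2 * inner ℝ (pull B v) b
  rw [real_inner_comm, mul_comm, ← h.integral_label_mul_affine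
    (aY * inner ℝ b (pull B v) + inner ℝ aX (pull B v)) (inner ℝ b (pull B v)) (pull B v)]
  refine integral_congr_ae (.of_forall fun e => ?_)
  simp only [real_inner_smul_right]
  rw [real_inner_comm, inner_scmSolution]
  ring

theorem integral_label_sq (h : IsNoise noise S σ) (B : Matrix (Fin d) (Fin d) ℝ)
    (b aX : Vec d) (aY : ℝ) :
    ∫ z, (z.2 - aY) ^ 2 ∂(noise.map (scmSolution B b aX aY)) = σ ^ 2 := by
  rw [integral_map_scmSolution B b aX aY (by fun_prop), ← h.var_Y]
  simp [scmSolution]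

theorem integral_inner_mul_label (h : IsNoise noise S σ) (B : Matrix (Fin d) (Fin d) ℝ)
    (b aX : Vec d) (aY c : ℝ) (β : Vec d) :
    ∫ z, (inner ℝ z.1 β - c) * (z.2 - aY) ∂(noise.map (scmSolution B b aX aY)) =
      inner ℝ b (pull B β) * σ ^ 2 := by
  rw [integral_map_scmSolution B b aX aY (by fun_prop)]
  rw [← h.integral_label_mul_affine (aY * inner ℝ b (pull B β) + inner ℝ aX (pull B β) - c)
      (inner ℝ b (pull B β)) (pull B β)]
  refine integral_congr_ae (.of_forall fun e => ?_)
  simp only [inner_scmSolution]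
  simp only [scmSolution]
  ring

/-- The moment matched by the residual matching estimators. -/
theorem integral_matching (h : IsNoise noise S σ) (B : Matrix (Fin d) (Fin d) ℝ)
    (b aX : Vec d) (aY : ℝ) (β γ : Vec d) (k : ℝ) :
    ∫ z, inner ℝ β (z.1 - (inner ℝ z.1 γ) • (k • Matrix.toEuclideanLin (1 - B)⁻¹ b))
        ∂(noise.map (scmSolution B b aX aY)) =
      (aY * inner ℝ b (pull B β) + inner ℝ aX (pull B β)) -
        k * inner ℝ b (pull B β) * (aY * inner ℝ b (pull B γ) + inner ℝ aX (pull B γ)) := by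
  have h1 : ∀ z : Vec d × ℝ,
      inner ℝ β (z.1 - (inner ℝ z.1 γ) • (k • Matrix.toEuclideanLin (1 - B)⁻¹ b)) =
        inner ℝ z.1 β - k * inner ℝ b (pull B β) * inner ℝ z.1 γ := by
    intro z
    rw [inner_sub_right, real_inner_smul_right, real_inner_smul_right,
      ← LinearMap.adjoint_inner_left]
    change _ - _ * (k * inner ℝ (pull B β) b) = _
    rw [real_inner_comm β, real_inner_comm b]
    ring
  simp_rw [h1]
  rw [integral_sub (integrable_inner_covariate h B b aX aY β)
    ((integrable_inner_covariate h B b aX aY γ).const_mul _), integral_const_mul,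
    integral_inner_covariate h, integral_inner_covariate h]

end Environment

/-! ### Invariance of the conditional mean given the label -/

section CondMean

variable {d : ℕ} {noise : Measure (Vec d × ℝ)} {S : Matrix (Fin d) (Fin d) ℝ} {σ : ℝ}

/-- `h` is a measurable version of the regression function `y ↦ E[εXᵀw | εY = y]` of the noise,
expressed through integrals over events determined by `εY`. -/
structure IsNoiseRegression (noise : Measure (Vec d × ℝ)) (w : Vec d) (h : ℝ → ℝ) : Prop where
  measurable : Measurable h
  integrable : Integrable (fun e : Vec d × ℝ => h e.2) noise
  setIntegral_eq : ∀ U : Set ℝ, MeasurableSet U →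
    ∫ e in Prod.snd ⁻¹' U, h e.2 ∂noise = ∫ e in Prod.snd ⁻¹' U, inner ℝ e.1 w ∂noise

theorem exists_isNoiseRegression (hn : IsNoise noise S σ) (w : Vec d) :
    ∃ h, IsNoiseRegression noise w h := by
  have := hn.prob
  have hX : Integrable (fun e : Vec d × ℝ => inner ℝ e.1 w) noise :=
    (hn.memLp_inner w).integrable (by norm_num)
  have hm := (measurable_snd : Measurable (Prod.snd : Vec d × ℝ → ℝ)).comap_le
  obtain ⟨h, hh, hc⟩ := (stronglyMeasurable_condExp (μ := noise)
    (m := MeasurableSpace.comap (Prod.snd : Vec d × ℝ → ℝ) inferInstance)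
    (f := fun e : Vec d × ℝ => (inner ℝ e.1 w : ℝ))).measurable.exists_eq_measurable_comp
  have hc' : (fun e : Vec d × ℝ => h e.2) = noise[fun e : Vec d × ℝ => (inner ℝ e.1 w : ℝ) |
      MeasurableSpace.comap Prod.snd inferInstance] := hc.symm
  refine ⟨h, hh, ?_, fun U hU => ?_⟩
  · rw [hc']
    exact integrable_condExp
  · rw [hc']
    exact setIntegral_condExp hm hX ⟨U, hU, rfl⟩

theorem isNoiseRegression_zero (hn : IsNoise noise S σ)
    (h0 : noise[(fun e : Vec d × ℝ => e.1) | MeasurableSpace.comap Prod.snd inferInstance]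
      =ᵐ[noise] 0) (w : Vec d) : IsNoiseRegression noise w 0 := by
  have := hn.prob
  have hX : Integrable (fun e : Vec d × ℝ => e.1) noise := hn.memLp_X.integrable (by norm_num)
  have hm := (measurable_snd : Measurable (Prod.snd : Vec d × ℝ → ℝ)).comap_le
  refine ⟨measurable_const, by simp, fun U hU => ?_⟩
  have h1 : ∫ e in Prod.snd ⁻¹' U, e.1 ∂noise = 0 := by
    rw [← setIntegral_condExp hm hX ⟨U, hU, rfl⟩,
      setIntegral_congr_ae (g := 0) (hm _ ⟨U, hU, rfl⟩) (h0.mono fun x hx _ => hx)]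
    simp
  have h2 := integral_inner (𝕜 := ℝ) (hX.integrableOn (s := Prod.snd ⁻¹' U)) w
  rw [h1, inner_zero_right] at h2
  simp only [Pi.zero_apply, integral_zero]
  rw [← h2]
  exact integral_congr_ae (.of_forall fun e => real_inner_comm (F := Vec d) e.1 w)

/-- The regression of `Xᵀβ` on the label in an environment: a shift of the label and of the
covariates acts on the regression function of the noise. -/
theorem condExp_inner_covariate (hn : IsNoise noise S σ) (B : Matrix (Fin d) (Fin d) ℝ)
    (b aX : Vec d) (aY : ℝ) (β : Vec d) {h : ℝ → ℝ}
    (hh : IsNoiseRegression noise (pull B β) h) :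
    (noise.map (scmSolution B b aX aY))[(fun z : Vec d × ℝ => inner ℝ z.1 β) |
        MeasurableSpace.comap Prod.snd inferInstance]
      =ᵐ[noise.map (scmSolution B b aX aY)]
      fun z => z.2 * inner ℝ b (pull B β) + inner ℝ aX (pull B β) + h (z.2 - aY) := by
  have := hn.prob
  have hS := measurable_scmSolution B b aX aY
  have := Measure.isProbabilityMeasure_map (μ := noise) hS.aemeasurable
  have hm := (measurable_snd : Measurable (Prod.snd : Vec d × ℝ → ℝ)).comap_le
  have hhm := hh.measurable
  have hgm : Measurable fun y : ℝ =>
      y * inner ℝ b (pull B β) + inner ℝ aX (pull B β) + h (y - aY) := by fun_prop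
  have hX : Integrable (fun e : Vec d × ℝ => inner ℝ e.1 (pull B β)) noise :=
    (hn.memLp_inner _).integrable (by norm_num)
  have hL : Integrable (fun e : Vec d × ℝ =>
      (aY + e.2) * inner ℝ b (pull B β) + inner ℝ aX (pull B β)) noise :=
    (((integrable_const aY).add (hn.memLp_Y.integrable (by norm_num))).mul_const _).add
      (integrable_const _)
  have hg : Integrable (fun z : Vec d × ℝ =>
      z.2 * inner ℝ b (pull B β) + inner ℝ aX (pull B β) + h (z.2 - aY))
      (noise.map (scmSolution B b aX aY)) := by
    refine (integrable_map_measure (hgm.comp measurable_snd).aestronglyMeasurable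
      hS.aemeasurable).2 ?_
    refine (hL.add hh.integrable).congr (.of_forall fun e => ?_)
    simp [scmSolution]
  refine (ae_eq_condExp_of_forall_setIntegral_eq hm (integrable_inner_covariate hn B b aX aY β)
    (fun s _ _ => hg.integrableOn) ?_ ?_).symm
  · rintro s ⟨U, hU, rfl⟩ -
    have hU' : MeasurableSet ((fun y => aY + y) ⁻¹' U) := by measurability
    rw [setIntegral_map (hm _ ⟨U, hU, rfl⟩) hg.aestronglyMeasurable hS.aemeasurable,
      setIntegral_map (hm _ ⟨U, hU, rfl⟩)
        (integrable_inner_covariate hn B b aX aY β).aestronglyMeasurable hS.aemeasurable]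
    have hpre : scmSolution B b aX aY ⁻¹' (Prod.snd ⁻¹' U) =
        Prod.snd ⁻¹' ((fun y => aY + y) ⁻¹' U) := rfl
    simp_rw [hpre, inner_scmSolution]
    simp only [scmSolution, add_sub_cancel_left]
    rw [integral_add hL.integrableOn hh.integrable.integrableOn,
      integral_add hL.integrableOn hX.integrableOn, hh.setIntegral_eq _ hU']
  · exact (hgm.comp (comap_measurable Prod.snd)).aestronglyMeasurable

/-- Conditional means given the label agree in two environments with overlapping label laws
exactly when `w` does not see the difference of the covariate interventions. -/
theorem sameCondMean_iff (hn : IsNoise noise S σ) (B : Matrix (Fin d) (Fin d) ℝ)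
    (b aX aX' : Vec d) (aY aY' : ℝ) (β : Vec d) {h : ℝ → ℝ}
    (hh : IsNoiseRegression noise (pull B β) h) (hshift : ∀ y, h (y - aY) = h (y - aY'))
    (hsing : ¬ (noise.map fun e => aY + e.2).MutuallySingular (noise.map fun e => aY' + e.2)) :
    SameCondMean (noise.map (scmSolution B b aX aY)) (noise.map (scmSolution B b aX' aY')) β ↔
      inner ℝ (aX - aX') (pull B β) = 0 := by
  have c1 := condExp_inner_covariate hn B b aX aY β hh
  have c2 := condExp_inner_covariate hn B b aX' aY' β hh
  have hhm := hh.measurable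
  rw [inner_sub_left, sub_eq_zero]
  constructor
  · rintro ⟨g, hg, g1, g2⟩
    by_contra hne
    apply hsing
    have key : ∀ (x : Vec d) (y₀ : ℝ),
        (fun z : Vec d × ℝ => g z.2) =ᵐ[noise.map (scmSolution B b x y₀)]
          (fun z => z.2 * inner ℝ b (pull B β) + inner ℝ x (pull B β) + h (z.2 - y₀)) →
        (noise.map fun e => y₀ + e.2)
          {y | g y = y * inner ℝ b (pull B β) + inner ℝ x (pull B β) + h (y - y₀)}ᶜ = 0 := by
      intro x y₀ hx
      have hms : MeasurableSet
          {y | g y = y * inner ℝ b (pull B β) + inner ℝ x (pull B β) + h (y - y₀)} :=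
        measurableSet_eq_fun hg (by fun_prop)
      rw [Measure.map_apply (by fun_prop) hms.compl]
      have h1 := ae_of_ae_map (measurable_scmSolution B b x y₀).aemeasurable hx
      exact measure_mono_null (fun e he => he) h1
    have k1 := key aX aY (g1.symm.trans c1)
    have k2 := key aX' aY' (g2.symm.trans c2)
    refine ⟨{y | g y = y * inner ℝ b (pull B β) + inner ℝ aX (pull B β) + h (y - aY)}ᶜ,
      (measurableSet_eq_fun hg (by fun_prop)).compl, k1, ?_⟩
    rw [compl_compl]
    refine measure_mono_null (fun y hy => ?_) k2
    rw [Set.mem_compl_iff]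
    intro hy'
    apply hne
    have e1 : g y = y * inner ℝ b (pull B β) + inner ℝ aX (pull B β) + h (y - aY) := hy
    have e2 : g y = y * inner ℝ b (pull B β) + inner ℝ aX' (pull B β) + h (y - aY') := hy'
    rw [hshift] at e1
    linarith
  · intro heq
    refine ⟨fun y => y * inner ℝ b (pull B β) + inner ℝ aX (pull B β) + h (y - aY),
      by fun_prop, c1, ?_⟩
    simp only [heq, hshift]
    exact c2

theorem LabelComparable.sameCondMean_iff {M : ℕ} [NeZero M] (hn : IsNoise noise S σ)
    {aY : Fin M → ℝ} (hc : LabelComparable noise aY) (B : Matrix (Fin d) (Fin d) ℝ)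
    (b aX aX' : Vec d) (m : Fin M) (β : Vec d) :
    SameCondMean (noise.map (scmSolution B b aX (aY m)))
        (noise.map (scmSolution B b aX' (aY 0))) β ↔
      inner ℝ (aX - aX') (pull B β) = 0 := by
  by_cases hall : ∃ m, aY m ≠ aY 0
  · obtain ⟨h0, hs⟩ := hc hall
    exact AnticausalDA.sameCondMean_iff hn B b aX aX' _ _ β (isNoiseRegression_zero hn h0 _)
      (fun _ => rfl) (hs m)
  · push Not at hall
    obtain ⟨h, hh⟩ := exists_isNoiseRegression hn (pull B β)
    refine AnticausalDA.sameCondMean_iff hn B b aX aX' _ _ β hh (fun y => by rw [hall m]) ?_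
    have := hn.prob
    rw [hall m, Measure.MutuallySingular.self_iff]
    have : IsProbabilityMeasure (noise.map fun e => aY 0 + e.2) :=
      Measure.isProbabilityMeasure_map (by fun_prop)
    exact IsProbabilityMeasure.ne_zero _

end CondMean

/-! ### Two least-norm problems -/

theorem isArgmin_iff_eq {α : Type*} {f : α → ℝ} {F : Set α} {θ₀ : α} (h₀ : θ₀ ∈ F)
    (hmin : ∀ η ∈ F, f θ₀ ≤ f η) (huniq : ∀ η ∈ F, f η ≤ f θ₀ → η = θ₀) (θ : α) :
    IsArgmin f F θ ↔ θ = θ₀ :=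
  ⟨fun h => huniq θ h.1 (h.2 θ₀ h₀), fun h => h ▸ ⟨h₀, hmin⟩⟩

section LeastNorm

variable {d : ℕ} {B : Matrix (Fin d) (Fin d) ℝ} {K : Submodule ℝ (Vec d)} {a b : Vec d} {s : ℝ}
  {F : Set (Vec d × ℝ)} {f : Vec d × ℝ → ℝ}

theorem inner_eq_inner_orthogonal_starProjection {w : Vec d} (hw : w ∈ Kᗮ) (b : Vec d) :
    inner ℝ b w = inner ℝ (Kᗮ.starProjection b) w := by
  rw [Submodule.inner_starProjection_left_eq_right, Submodule.starProjection_eq_self_iff.2 hw]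

theorem norm_sq_orthogonal_starProjection (b : Vec d) :
    ‖Kᗮ.starProjection b‖ ^ 2 = ‖b‖ ^ 2 - ‖K.starProjection b‖ ^ 2 := by
  rw [Submodule.norm_sq_eq_add_norm_sq_starProjection b K]
  ring

theorem orthogonal_starProjection_ne_zero (hb : b ∉ K) : Kᗮ.starProjection b ≠ 0 := by
  intro h0
  apply hb
  have h1 := K.starProjection_add_starProjection_orthogonal b
  rw [h0, add_zero] at h1
  exact h1 ▸ K.starProjection_apply_mem b

/-- Minimizing a variance over the `w ⊥ K` with `bᵀw = 1`: the minimizer is `p / ‖p‖²`, where `p`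
is the component of `b` orthogonal to `K`. -/
theorem exists_argmin_of_constraint (hB : IsUnit (1 - B)) (hb : b ∉ K) (hs : 0 < s)
    (hF : ∀ θ, θ ∈ F ↔ inner ℝ b (pull B θ.1) = 1 ∧ pull B θ.1 ∈ Kᗮ)
    (hf : ∀ θ ∈ F, f θ = (inner ℝ a (pull B θ.1) + θ.2) ^ 2 + s * ‖pull B θ.1‖ ^ 2) :
    ∃ θ₀ ∈ F, inner ℝ a (pull B θ₀.1) + θ₀.2 = 0 ∧
      ‖pull B θ₀.1‖ ^ 2 = 1 / (‖b‖ ^ 2 - ‖K.starProjection b‖ ^ 2) ∧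
      ∀ θ, IsArgmin f F θ ↔ θ = θ₀ := by
  obtain ⟨p, hp⟩ : ∃ p, p = Kᗮ.starProjection b := ⟨_, rfl⟩
  have hp0 : p ≠ 0 := hp ▸ orthogonal_starProjection_ne_zero hb
  have hpn : 0 < ‖p‖ ^ 2 := by positivity
  have hpK : p ∈ Kᗮ := hp ▸ Kᗮ.starProjection_apply_mem b
  obtain ⟨w, hw⟩ : ∃ w, w = (‖p‖ ^ 2)⁻¹ • p := ⟨_, rfl⟩
  have hwK : w ∈ Kᗮ := hw ▸ Kᗮ.smul_mem _ hpK
  obtain ⟨β, hβ⟩ := (pull_bijective hB).2 w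
  have hbw : inner ℝ b w = 1 := by
    rw [inner_eq_inner_orthogonal_starProjection hwK, ← hp, hw, real_inner_smul_right,
      real_inner_self_eq_norm_sq]
    field_simp
  have hmem : (β, -inner ℝ a w) ∈ F := by
    rw [hF]
    simp only [hβ]
    exact ⟨hbw, hwK⟩
  have hval : f (β, -inner ℝ a w) = s * ‖w‖ ^ 2 := by
    rw [hf _ hmem]
    simp [hβ]
  have hpyth : ∀ η ∈ F, ‖pull B η.1‖ ^ 2 = ‖w‖ ^ 2 + ‖pull B η.1 - w‖ ^ 2 := by
    intro η hη
    obtain ⟨h1, h2⟩ := (hF η).1 hη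
    have h3 : inner ℝ w (pull B η.1 - w) = 0 := by
      rw [hw, real_inner_smul_left, inner_sub_right, ← hw, hp,
        ← inner_eq_inner_orthogonal_starProjection h2,
        ← inner_eq_inner_orthogonal_starProjection hwK, h1, hbw]
      simp
    have h4 := norm_add_sq_real w (pull B η.1 - w)
    rw [h3, add_sub_cancel] at h4
    rw [h4]
    ring
  refine ⟨(β, -inner ℝ a w), hmem, by simp [hβ], ?_, isArgmin_iff_eq hmem ?_ ?_⟩
  · simp only [hβ]
    rw [← norm_sq_orthogonal_starProjection, ← hp, hw, norm_smul, mul_pow, norm_inv, norm_pow,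
      norm_norm]
    field_simp
  · intro η hη
    rw [hval, hf η hη, hpyth η hη]
    nlinarith [sq_nonneg (inner ℝ a (pull B η.1) + η.2),
      mul_nonneg hs.le (sq_nonneg ‖pull B η.1 - w‖)]
  · intro η hη hle
    rw [hval, hf η hη, hpyth η hη] at hle
    have h1 := sq_nonneg (inner ℝ a (pull B η.1) + η.2)
    have h2 : 0 ≤ s * ‖pull B η.1 - w‖ ^ 2 := by positivity
    have h3 : s * ‖pull B η.1 - w‖ ^ 2 = 0 := by linarith
    have h4 : pull B η.1 = w := by
      have := (mul_eq_zero.1 h3).resolve_left hs.ne'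
      simpa [sub_eq_zero] using this
    have h5 : (inner ℝ a (pull B η.1) + η.2) ^ 2 = 0 := by linarith
    have h6 : inner ℝ a (pull B η.1) + η.2 = 0 := by simpa using h5
    refine Prod.ext ((pull_bijective hB).1 (h4.trans hβ.symm)) ?_
    simp only
    rw [h4] at h6
    linarith

/-- Minimizing over the `w ⊥ K` a variance plus a penalty for `bᵀw ≠ 1`: the minimizer is a nonzero
multiple of the component `p` of `b` orthogonal to `K`. -/
theorem exists_argmin_of_penalty (hB : IsUnit (1 - B)) (hb : b ∉ K) (hs : 0 < s) {τ α : ℝ}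
    (hτ : 0 < τ) (hF : ∀ θ, θ ∈ F ↔ pull B θ.1 ∈ Kᗮ)
    (hf : ∀ θ ∈ F, f θ = (α * (1 - inner ℝ b (pull B θ.1)) - inner ℝ a (pull B θ.1) - θ.2) ^ 2 +
      τ * (1 - inner ℝ b (pull B θ.1)) ^ 2 + s * ‖pull B θ.1‖ ^ 2) :
    ∃ θ₀ ∈ F, inner ℝ b (pull B θ₀.1) ≠ 0 ∧ ∀ θ, IsArgmin f F θ ↔ θ = θ₀ := by
  obtain ⟨p, hp⟩ : ∃ p, p = Kᗮ.starProjection b := ⟨_, rfl⟩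
  have hp0 : p ≠ 0 := hp ▸ orthogonal_starProjection_ne_zero hb
  have hpn : 0 < ‖p‖ ^ 2 := by positivity
  have hpK : p ∈ Kᗮ := hp ▸ Kᗮ.starProjection_apply_mem b
  obtain ⟨l, hl⟩ : ∃ l, l = τ / (s + τ * ‖p‖ ^ 2) := ⟨_, rfl⟩
  have hl0 : 0 < l := by rw [hl]; positivity
  have hl1 : s * l = τ * (1 - l * ‖p‖ ^ 2) := by rw [hl]; field_simp; ring
  obtain ⟨w, hw⟩ : ∃ w, w = l • p := ⟨_, rfl⟩
  have hwK : w ∈ Kᗮ := hw ▸ Kᗮ.smul_mem _ hpK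
  obtain ⟨β, hβ⟩ := (pull_bijective hB).2 w
  have hbw : inner ℝ b w = l * ‖p‖ ^ 2 := by
    rw [inner_eq_inner_orthogonal_starProjection hwK, ← hp, hw, real_inner_smul_right,
      real_inner_self_eq_norm_sq]
  have hmem : (β, α * (1 - inner ℝ b w) - inner ℝ a w) ∈ F := by
    rw [hF]
    simp only [hβ]
    exact hwK
  have hval : f (β, α * (1 - inner ℝ b w) - inner ℝ a w) =
      τ * (1 - inner ℝ b w) ^ 2 + s * ‖w‖ ^ 2 := by
    rw [hf _ hmem]
    simp [hβ]
  -- The objective is quadratic and its gradient vanishes at `w`.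
  have hquad : ∀ η ∈ F, τ * (1 - inner ℝ b (pull B η.1)) ^ 2 + s * ‖pull B η.1‖ ^ 2 =
      τ * (1 - inner ℝ b w) ^ 2 + s * ‖w‖ ^ 2 + τ * (inner ℝ b (pull B η.1 - w)) ^ 2 +
        s * ‖pull B η.1 - w‖ ^ 2 := by
    intro η hη
    have h2 := (hF η).1 hη
    have h3 : inner ℝ w (pull B η.1 - w) = l * inner ℝ b (pull B η.1 - w) := by
      rw [inner_eq_inner_orthogonal_starProjection (Kᗮ.sub_mem h2 hwK) b, ← hp]
      nth_rewrite 1 [hw]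
      rw [real_inner_smul_left]
    have h4 := norm_add_sq_real w (pull B η.1 - w)
    rw [h3, add_sub_cancel] at h4
    have h5 : inner ℝ b (pull B η.1) = l * ‖p‖ ^ 2 + inner ℝ b (pull B η.1 - w) := by
      rw [inner_sub_right, hbw]
      ring
    rw [h4, h5, hbw]
    linear_combination (2 * inner ℝ b (pull B η.1 - w)) * hl1
  refine ⟨(β, α * (1 - inner ℝ b w) - inner ℝ a w), hmem, ?_, isArgmin_iff_eq hmem ?_ ?_⟩
  · simp only [hβ, hbw]
    positivity
  · intro η hη
    rw [hval, hf η hη, add_assoc, hquad η hη]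
    have h1 := sq_nonneg (α * (1 - inner ℝ b (pull B η.1)) - inner ℝ a (pull B η.1) - η.2)
    have h2 : 0 ≤ s * ‖pull B η.1 - w‖ ^ 2 := by positivity
    have h3 : 0 ≤ τ * (inner ℝ b (pull B η.1 - w)) ^ 2 := by positivity
    linarith
  · intro η hη hle
    rw [hval, hf η hη, add_assoc, hquad η hη] at hle
    have h1 := sq_nonneg (α * (1 - inner ℝ b (pull B η.1)) - inner ℝ a (pull B η.1) - η.2)
    have h2 : 0 ≤ s * ‖pull B η.1 - w‖ ^ 2 := by positivity
    have h3 : 0 ≤ τ * (inner ℝ b (pull B η.1 - w)) ^ 2 := by positivity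
    have h4 : s * ‖pull B η.1 - w‖ ^ 2 = 0 := by linarith
    have h5 : pull B η.1 = w := by
      have := (mul_eq_zero.1 h4).resolve_left hs.ne'
      simpa [sub_eq_zero] using this
    have h6 : (α * (1 - inner ℝ b (pull B η.1)) - inner ℝ a (pull B η.1) - η.2) ^ 2 = 0 := by
      linarith
    have h7 : α * (1 - inner ℝ b (pull B η.1)) - inner ℝ a (pull B η.1) - η.2 = 0 := by
      simpa using h6
    refine Prod.ext ((pull_bijective hB).1 (h5.trans hβ.symm)) ?_
    simp only
    rw [h5] at h7
    linarith

end LeastNorm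

/-! ### The estimators for fixed interventions -/

namespace Model

variable {d M : ℕ} {E : Model d M} {σ ρ : ℝ}

theorem mem_orthogonal_interventionSpan [NeZero M] (E : Model d M) (w : Vec d) :
    w ∈ E.interventionSpanᗮ ↔ ∀ m, inner ℝ (E.aX m - E.aX 0) w = 0 := by
  constructor
  · intro h m
    exact (Submodule.mem_orthogonal _ _).1 h _ (Submodule.subset_span ⟨m, rfl⟩)
  · intro h
    have h1 : E.interventionSpan ≤ (Submodule.span ℝ {w})ᗮ := by
      rw [interventionSpan, Submodule.span_le]
      rintro _ ⟨m, rfl⟩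
      exact Submodule.mem_orthogonal_singleton_iff_inner_left.2 (h m)
    exact Submodule.le_orthogonal_iff_le_orthogonal.1 h1 (Submodule.mem_span_singleton_self w)

/-- The target risk of a unique estimator with `bᵀw = 1` and unbiased residuals in the target: only
the contribution `(σ² / ρ) ‖w‖²` of the noise is left. -/
theorem hasTargetRisk_of_iff_eq
    (hn : IsNoise E.noise ((σ ^ 2 / ρ) • (1 : Matrix (Fin d) (Fin d) ℝ)) σ)
    {Est : Vec d × ℝ → Prop} {θ₀ : Vec d × ℝ} {q : ℝ} (hEst : ∀ θ, Est θ ↔ θ = θ₀)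
    (hb : inner ℝ E.b (pull E.B θ₀.1) = 1) (ha : inner ℝ E.aXt (pull E.B θ₀.1) + θ₀.2 = 0)
    (hq : ‖pull E.B θ₀.1‖ ^ 2 = 1 / q) : E.HasTargetRisk Est (σ ^ 2 / (ρ * q)) := by
  refine ⟨⟨θ₀, (hEst θ₀).2 rfl, fun θ hθ => (hEst θ).1 hθ⟩, fun θ hθ => ?_⟩
  rw [(hEst θ).1 hθ, targetRisk, target, mse_eq hn, hb, hq]
  have h1 : E.aYt * (1 - 1) - inner ℝ E.aXt (pull E.B θ₀.1) - θ₀.2 = 0 := by linarith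
  rw [h1, div_mul_div_comm]
  simp

/-- The RII estimator is unique; in structural coordinates it is `p / ‖p‖²`, where `p` is the
component of `b` orthogonal to the intervention span. -/
theorem exists_forall_isRII_iff [NeZero M] (hM : 2 ≤ M) (hB : IsUnit (1 - E.B)) (hσ : 0 < σ)
    (hρ : 0 < ρ) (hn : IsNoise E.noise ((σ ^ 2 / ρ) • (1 : Matrix (Fin d) (Fin d) ℝ)) σ)
    (hb : E.b ∉ E.interventionSpan) :
    ∃ θ₀, (∀ θ, E.IsRII θ ↔ θ = θ₀) ∧ inner ℝ E.b (pull E.B θ₀.1) = 1 ∧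
      pull E.B θ₀.1 ∈ E.interventionSpanᗮ ∧ inner ℝ (E.aX 0) (pull E.B θ₀.1) + θ₀.2 = 0 ∧
      ‖pull E.B θ₀.1‖ ^ 2 = 1 / (‖E.b‖ ^ 2 - ‖E.interventionSpan.starProjection E.b‖ ^ 2) := by
  have hM0 : (M : ℝ) ≠ 0 := by positivity
  have hF : ∀ θ : Vec d × ℝ, θ ∈ {θ : Vec d × ℝ | ∀ m : Fin M, m ≠ 0 →
      ∫ z, (z.2 - inner ℝ z.1 θ.1) ∂(E.source m) = ∫ z, (z.2 - inner ℝ z.1 θ.1) ∂(E.source 0) ∧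
      ResidualIndep (E.source m) θ.1} ↔
      inner ℝ E.b (pull E.B θ.1) = 1 ∧ pull E.B θ.1 ∈ E.interventionSpanᗮ := by
    intro θ
    simp only [Set.mem_ofPred_eq, source, integral_residual hn, residualIndep_iff hn hσ]
    rw [mem_orthogonal_interventionSpan]
    constructor
    · intro h
      have h1 := (h ⟨1, hM⟩ (by simp [Fin.ext_iff])).2
      refine ⟨h1, fun m => ?_⟩
      by_cases hm : m = 0
      · simp [hm]
      · have h2 := (h m hm).1
        rw [inner_sub_left]
        rw [h1] at h2
        linarith
    · rintro ⟨h1, h2⟩ m -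
      have h3 := h2 m
      rw [inner_sub_left] at h3
      refine ⟨?_, h1⟩
      rw [h1]
      linarith
  obtain ⟨θ₀, h1, h2, h3, h4⟩ := exists_argmin_of_constraint (f := E.pooledRisk) (a := E.aX 0) hB
    hb (s := σ ^ 2 / ρ) (by positivity) hF (by
      intro θ hθ
      obtain ⟨h1, h2⟩ := (hF θ).1 hθ
      rw [mem_orthogonal_interventionSpan] at h2
      have h3 : ∀ k, mse (E.source k) θ =
          (inner ℝ (E.aX 0) (pull E.B θ.1) + θ.2) ^ 2 + σ ^ 2 / ρ * ‖pull E.B θ.1‖ ^ 2 := by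
        intro k
        rw [source, mse_eq hn, h1]
        have := h2 k
        rw [inner_sub_left, sub_eq_zero] at this
        rw [this]
        ring
      simp only [pooledRisk, h3, Finset.sum_const, Finset.card_univ, Fintype.card_fin,
        nsmul_eq_mul]
      field_simp)
  obtain ⟨h5, h6⟩ := (hF θ₀).1 h1
  exact ⟨θ₀, h4, h5, h6, h2, h3⟩

/-- The CIP estimator is unique; in structural coordinates it is orthogonal to the intervention
span and it has a nonzero label effect `bᵀw`. -/
theorem exists_forall_isCIP_iff [NeZero M] (hB : IsUnit (1 - E.B)) (hσ : 0 < σ)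
    (hρ : 0 < ρ) (hn : IsNoise E.noise ((σ ^ 2 / ρ) • (1 : Matrix (Fin d) (Fin d) ℝ)) σ)
    (hc : LabelComparable E.noise E.aY) (hb : E.b ∉ E.interventionSpan) :
    ∃ θ₀, (∀ θ, E.IsCIP θ ↔ θ = θ₀) ∧ inner ℝ E.b (pull E.B θ₀.1) ≠ 0 ∧
      pull E.B θ₀.1 ∈ E.interventionSpanᗮ := by
  have hM0 : (M : ℝ) ≠ 0 := Nat.cast_ne_zero.2 (NeZero.ne M)
  have hF : ∀ θ : Vec d × ℝ,
      θ ∈ {θ : Vec d × ℝ | ∀ m : Fin M, m ≠ 0 →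
        SameCondMean (E.source m) (E.source 0) θ.1} ↔
      pull E.B θ.1 ∈ E.interventionSpanᗮ := by
    intro θ
    simp only [Set.mem_ofPred_eq, source, hc.sameCondMean_iff hn]
    rw [mem_orthogonal_interventionSpan]
    refine ⟨fun h m => ?_, fun h m _ => h m⟩
    by_cases hm : m = 0
    · simp [hm]
    · exact h m hm
  -- The pooled risk splits by the mean `α` and the variance of the label interventions.
  obtain ⟨α, hα⟩ : ∃ α, α = (1 / (M : ℝ)) * ∑ k, E.aY k := ⟨_, rfl⟩
  obtain ⟨v, hv⟩ : ∃ v, v = (1 / (M : ℝ)) * ∑ k, (E.aY k - α) ^ 2 := ⟨_, rfl⟩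
  have hv0 : 0 ≤ v := by
    rw [hv]
    exact mul_nonneg (by positivity) (Finset.sum_nonneg fun _ _ => sq_nonneg _)
  have hsplit : ∀ t c : ℝ, (1 / (M : ℝ)) * ∑ k, (E.aY k * t - c) ^ 2 =
      (α * t - c) ^ 2 + v * t ^ 2 := by
    intro t c
    have h1 : ∀ k, (E.aY k * t - c) ^ 2 =
        t ^ 2 * (E.aY k - α) ^ 2 + 2 * t * (α * t - c) * E.aY k +
          (c ^ 2 - α ^ 2 * t ^ 2) := fun k => by ring
    have h2 : ∑ k, E.aY k = M * α := by rw [hα]; field_simp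
    have h3 : ∑ k, (E.aY k - α) ^ 2 = M * v := by rw [hv]; field_simp
    simp only [h1, Finset.sum_add_distrib, ← Finset.mul_sum, h2, h3, Finset.sum_const,
      Finset.card_univ, Fintype.card_fin, nsmul_eq_mul]
    field_simp
    ring
  obtain ⟨θ₀, h1, h2, h3⟩ := exists_argmin_of_penalty (f := E.pooledRisk) (a := E.aX 0) hB
    hb (s := σ ^ 2 / ρ) (by positivity) (τ := v + σ ^ 2) (α := α) (by positivity) hF (by
      intro θ hθ
      have h2 := (hF θ).1 hθ
      rw [mem_orthogonal_interventionSpan] at h2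
      have h3 : ∀ k, mse (E.source k) θ =
          (E.aY k * (1 - inner ℝ E.b (pull E.B θ.1)) -
            (inner ℝ (E.aX 0) (pull E.B θ.1) + θ.2)) ^ 2 +
          ((1 - inner ℝ E.b (pull E.B θ.1)) ^ 2 * σ ^ 2 + σ ^ 2 / ρ * ‖pull E.B θ.1‖ ^ 2) := by
        intro k
        rw [source, mse_eq hn]
        have := h2 k
        rw [inner_sub_left, sub_eq_zero] at this
        rw [this]
        ring
      simp only [pooledRisk, h3, Finset.sum_add_distrib, mul_add, hsplit]
      simp only [Finset.sum_const, Finset.card_univ, Fintype.card_fin, nsmul_eq_mul]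
      field_simp
      ring)
  exact ⟨θ₀, h3, h2, (hF θ₀).1 h1⟩

theorem crossCov_eq [NeZero M]
    (hn : IsNoise E.noise ((σ ^ 2 / ρ) • (1 : Matrix (Fin d) (Fin d) ℝ)) σ) :
    E.crossCov = σ ^ 2 • Matrix.toEuclideanLin (1 - E.B)⁻¹ E.b := by
  have hM0 : (M : ℝ) ≠ 0 := Nat.cast_ne_zero.2 (NeZero.ne M)
  simp only [crossCov, source, integral_label hn, integral_label_smul_covariate hn,
    Finset.sum_const, Finset.card_univ, Fintype.card_fin]
  rw [← Nat.cast_smul_eq_nsmul ℝ, smul_smul, one_div, inv_mul_cancel₀ hM0, one_smul]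

theorem varthetaRIIRMI_eq [NeZero M] (hσ : 0 < σ)
    (hn : IsNoise E.noise ((σ ^ 2 / ρ) • (1 : Matrix (Fin d) (Fin d) ℝ)) σ) :
    E.varthetaRIIRMI = Matrix.toEuclideanLin (1 - E.B)⁻¹ E.b := by
  have hM0 : (M : ℝ) ≠ 0 := Nat.cast_ne_zero.2 (NeZero.ne M)
  have h1 : E.labelVar = σ ^ 2 := by
    simp only [labelVar, source, integral_label hn, integral_label_sq hn, Finset.sum_const,
      Finset.card_univ, Fintype.card_fin, nsmul_eq_mul]
    field_simp
  rw [varthetaRIIRMI, h1, crossCov_eq hn, smul_smul, inv_mul_cancel₀ (by positivity), one_smul]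

theorem varthetaCIRMI_eq [NeZero M] (hσ : 0 < σ)
    (hn : IsNoise E.noise ((σ ^ 2 / ρ) • (1 : Matrix (Fin d) (Fin d) ℝ)) σ) (γ : Vec d) :
    E.varthetaCIRMI γ =
      (inner ℝ E.b (pull E.B γ))⁻¹ • Matrix.toEuclideanLin (1 - E.B)⁻¹ E.b := by
  have hM0 : (M : ℝ) ≠ 0 := Nat.cast_ne_zero.2 (NeZero.ne M)
  have h1 : E.proxyCov γ = inner ℝ E.b (pull E.B γ) * σ ^ 2 := by
    simp only [proxyCov, source, integral_label hn, integral_inner_mul_label hn, Finset.sum_const,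
      Finset.card_univ, Fintype.card_fin, nsmul_eq_mul]
    field_simp
  rw [varthetaCIRMI, h1, crossCov_eq hn, smul_smul, mul_inv, mul_assoc,
    inv_mul_cancel₀ (by positivity), mul_one]

theorem norm_sq_starProjection_span_sub (E : Model d M) (m : Fin M) (x : Vec d) :
    ‖(Submodule.span ℝ {E.aX m - E.aXt}).starProjection x‖ ^ 2 = (inner ℝ (E.u m) x) ^ 2 := by
  rw [Submodule.starProjection_singleton, norm_smul, u, real_inner_smul_left]
  by_cases h : E.aX m - E.aXt = 0
  · simp [h]
  · have : ‖E.aX m - E.aXt‖ ≠ 0 := norm_ne_zero_iff.2 h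
    simp only [Real.norm_eq_abs, RCLike.ofReal_real_eq_id, id_eq, mul_pow, sq_abs]
    field_simp

/-- Since the proxy predicts the label up to the factor `bᵀ(pull γ)`, matching the moments of the
corrected covariates amounts to `w ⊥ aX m - aXt`. -/
theorem hasTargetRisk_isResidualMatching [NeZero M] (hB : IsUnit (1 - E.B)) (hσ : 0 < σ)
    (hρ : 0 < ρ) (hn : IsNoise E.noise ((σ ^ 2 / ρ) • (1 : Matrix (Fin d) (Fin d) ℝ)) σ)
    (ht : E.aXt - E.aX 0 ∈ E.interventionSpan) (hb : E.b ∉ E.interventionSpan) (m : Fin M)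
    {γ : Vec d} (hγ : pull E.B γ ∈ E.interventionSpanᗮ) (hγb : inner ℝ E.b (pull E.B γ) ≠ 0) :
    E.HasTargetRisk (E.IsResidualMatching m γ
        ((inner ℝ E.b (pull E.B γ))⁻¹ • Matrix.toEuclideanLin (1 - E.B)⁻¹ E.b))
      (σ ^ 2 / (ρ * ‖E.b‖ ^ 2 - ρ * (inner ℝ (E.u m) E.b) ^ 2)) := by
  have hV : E.aX m - E.aXt ∈ E.interventionSpan := by
    have h1 : E.aX m - E.aX 0 ∈ E.interventionSpan := Submodule.subset_span ⟨m, rfl⟩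
    simpa using E.interventionSpan.sub_mem h1 ht
  have hγ0 : inner ℝ (E.aX m) (pull E.B γ) = inner ℝ E.aXt (pull E.B γ) := by
    have := (Submodule.mem_orthogonal _ _).1 hγ _ hV
    rwa [inner_sub_left, sub_eq_zero] at this
  have hle : Submodule.span ℝ {E.aX m - E.aXt} ≤ E.interventionSpan := by
    rw [Submodule.span_singleton_le_iff_mem]
    exact hV
  have hF : ∀ θ : Vec d × ℝ, θ ∈ {θ : Vec d × ℝ |
      ∫ z, inner ℝ θ.1 (z.1 - (inner ℝ z.1 γ) • ((inner ℝ E.b (pull E.B γ))⁻¹ •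
          Matrix.toEuclideanLin (1 - E.B)⁻¹ E.b)) ∂(E.source m) =
        ∫ z, inner ℝ θ.1 (z.1 - (inner ℝ z.1 γ) • ((inner ℝ E.b (pull E.B γ))⁻¹ •
          Matrix.toEuclideanLin (1 - E.B)⁻¹ E.b)) ∂E.target ∧
      ResidualIndep (E.source m) θ.1} ↔
      inner ℝ E.b (pull E.B θ.1) = 1 ∧
        pull E.B θ.1 ∈ (Submodule.span ℝ {E.aX m - E.aXt})ᗮ := by
    intro θ
    simp only [Set.mem_ofPred_eq, source, target, integral_matching hn, residualIndep_iff hn hσ]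
    rw [Submodule.mem_orthogonal_singleton_iff_inner_right, inner_sub_left, and_comm]
    refine and_congr_right fun h1 => ?_
    rw [h1, hγ0]
    field_simp
    constructor
    · intro h
      refine mul_left_cancel₀ hγb ?_
      linear_combination h
    · intro h
      linear_combination (inner ℝ E.b (pull E.B γ)) * h
  obtain ⟨θ₀, h1, h2, h3, h4⟩ := exists_argmin_of_constraint (f := mse (E.source m))
    (a := E.aX m) hB (fun h => hb (hle h)) (s := σ ^ 2 / ρ) (by positivity) hF (by
      intro θ hθ
      obtain ⟨h1, h2⟩ := (hF θ).1 hθ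
      rw [source, mse_eq hn, h1]
      ring)
  obtain ⟨h5, h6⟩ := (hF θ₀).1 h1
  rw [← mul_sub, ← norm_sq_starProjection_span_sub]
  refine hasTargetRisk_of_iff_eq hn h4 h5 ?_ h3
  rw [Submodule.mem_orthogonal_singleton_iff_inner_right, inner_sub_left] at h6
  linarith

theorem hasTargetRisk_isRII [NeZero M] (hM : 2 ≤ M) (hB : IsUnit (1 - E.B)) (hσ : 0 < σ)
    (hρ : 0 < ρ) (hn : IsNoise E.noise ((σ ^ 2 / ρ) • (1 : Matrix (Fin d) (Fin d) ℝ)) σ)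
    (ht : E.aXt - E.aX 0 ∈ E.interventionSpan) (hb : E.b ∉ E.interventionSpan) :
    E.HasTargetRisk E.IsRII
      (σ ^ 2 / (ρ * (‖E.b‖ ^ 2 - ‖E.interventionSpan.starProjection E.b‖ ^ 2))) := by
  obtain ⟨θ₀, h1, h2, h3, h4, h5⟩ := exists_forall_isRII_iff hM hB hσ hρ hn hb
  refine hasTargetRisk_of_iff_eq hn h1 h2 ?_ h5
  have := (Submodule.mem_orthogonal _ _).1 h3 _ ht
  rw [inner_sub_left] at this
  linarith

theorem hasTargetRisk_isRIIRMI [NeZero M] (hM : 2 ≤ M) (hB : IsUnit (1 - E.B)) (hσ : 0 < σ)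
    (hρ : 0 < ρ) (hn : IsNoise E.noise ((σ ^ 2 / ρ) • (1 : Matrix (Fin d) (Fin d) ℝ)) σ)
    (ht : E.aXt - E.aX 0 ∈ E.interventionSpan) (hb : E.b ∉ E.interventionSpan) (m : Fin M) :
    E.HasTargetRisk (E.IsRIIRMI m)
      (σ ^ 2 / (ρ * ‖E.b‖ ^ 2 - ρ * (inner ℝ (E.u m) E.b) ^ 2)) := by
  obtain ⟨θ₀, h1, h2, h3, -, -⟩ := exists_forall_isRII_iff hM hB hσ hρ hn hb
  have h := hasTargetRisk_isResidualMatching hB hσ hρ hn ht hb m h3 (by rw [h2]; exact one_ne_zero)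
  rw [h2, inv_one, one_smul] at h
  have heq : E.IsRIIRMI m = E.IsResidualMatching m θ₀.1
      (Matrix.toEuclideanLin (1 - E.B)⁻¹ E.b) := by
    funext θ
    simp only [IsRIIRMI, h1, exists_eq_left, varthetaRIIRMI_eq hσ hn]
  rwa [heq]

theorem hasTargetRisk_isCIRMI [NeZero M] (hB : IsUnit (1 - E.B)) (hσ : 0 < σ)
    (hρ : 0 < ρ) (hn : IsNoise E.noise ((σ ^ 2 / ρ) • (1 : Matrix (Fin d) (Fin d) ℝ)) σ)
    (hc : LabelComparable E.noise E.aY)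
    (ht : E.aXt - E.aX 0 ∈ E.interventionSpan) (hb : E.b ∉ E.interventionSpan) (m : Fin M) :
    E.HasTargetRisk (E.IsCIRMI m)
      (σ ^ 2 / (ρ * ‖E.b‖ ^ 2 - ρ * (inner ℝ (E.u m) E.b) ^ 2)) := by
  obtain ⟨θ₀, h1, h2, h3⟩ := exists_forall_isCIP_iff hB hσ hρ hn hc hb
  have h := hasTargetRisk_isResidualMatching hB hσ hρ hn ht hb m h3 h2
  have heq : E.IsCIRMI m = E.IsResidualMatching m θ₀.1
      ((inner ℝ E.b (pull E.B θ₀.1))⁻¹ • Matrix.toEuclideanLin (1 - E.B)⁻¹ E.b) := by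
    funext θ
    simp only [IsCIRMI, h1, exists_eq_left, varthetaCIRMI_eq hσ hn]
  rwa [heq]

end Model

/-! ### Orthogonal projections of a standard Gaussian vector -/

section Gaussian

theorem integrable_exp_mul_sq_gaussianReal {a : ℝ} (ha : a < 1 / 2) :
    Integrable (fun x : ℝ => Real.exp (a * x ^ 2)) (gaussianReal 0 1) := by
  rw [gaussianReal_of_var_ne_zero _ one_ne_zero,
    integrable_withDensity_iff_integrable_smul' (by fun_prop)
      (ae_of_all _ fun x => gaussianPDF_lt_top)]
  refine ((integrable_exp_neg_mul_sq (b := 1 / 2 - a) (by linarith)).const_mul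
    (√(2 * Real.pi))⁻¹).congr (.of_forall fun x => ?_)
  simp only [toReal_gaussianPDF, gaussianPDFReal, smul_eq_mul, NNReal.coe_one, mul_one, sub_zero]
  rw [mul_assoc, ← Real.exp_add]
  congr 2
  ring

theorem integral_exp_mul_sq_gaussianReal {a : ℝ} (ha : a < 1 / 2) :
    ∫ x, Real.exp (a * x ^ 2) ∂(gaussianReal 0 1) = (√(1 - 2 * a))⁻¹ := by
  rw [integral_gaussianReal_eq_integral_smul one_ne_zero]
  have h1 : ∀ x : ℝ, gaussianPDFReal 0 1 x • Real.exp (a * x ^ 2) =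
      (√(2 * Real.pi))⁻¹ * Real.exp (-(1 / 2 - a) * x ^ 2) := by
    intro x
    simp only [gaussianPDFReal, smul_eq_mul, NNReal.coe_one, mul_one, sub_zero]
    rw [mul_assoc, ← Real.exp_add]
    congr 2
    ring
  simp_rw [h1]
  rw [integral_const_mul, integral_gaussian, ← Real.sqrt_inv, ← Real.sqrt_inv,
    ← Real.sqrt_mul (by positivity)]
  congr 1
  have h2 : (1 / 2 - a) ≠ 0 := by linarith
  have h3 : (1 - 2 * a) ≠ 0 := by linarith
  have := Real.pi_ne_zero
  field_simp

variable {E : Type*} [NormedAddCommGroup E] [InnerProductSpace ℝ E]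

theorem sum_inner_sq_eq_norm_sq_starProjection {ι : Type*} [Fintype ι] {V : Submodule ℝ E}
    [V.HasOrthogonalProjection] (P : OrthonormalBasis ι ℝ V) (x : E) :
    ∑ j, (inner ℝ (P j : E) x) ^ 2 = ‖V.starProjection x‖ ^ 2 := by
  have h1 := P.sum_sq_inner_right (V.orthogonalProjectionOnto x)
  rw [Submodule.starProjection_apply, ← Submodule.coe_norm, ← h1]
  refine Finset.sum_congr rfl fun j _ => ?_
  simp

variable [FiniteDimensional ℝ E] [MeasurableSpace E] [BorelSpace E]

/-- The joint exponential moments of the squared norms of the two components of a standard Gaussian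
vector along a subspace and its orthogonal complement. -/
theorem integral_exp_norm_sq_starProjection (V : Submodule ℝ E) {a c : ℝ} (ha : a < 1 / 2)
    (hc : c < 1 / 2) :
    Integrable (fun x => Real.exp (a * ‖V.starProjection x‖ ^ 2 + c * ‖Vᗮ.starProjection x‖ ^ 2))
        (stdGaussian E) ∧
      ∫ x, Real.exp (a * ‖V.starProjection x‖ ^ 2 + c * ‖Vᗮ.starProjection x‖ ^ 2)
        ∂(stdGaussian E) =
      (√(1 - 2 * a))⁻¹ ^ Module.finrank ℝ V * (√(1 - 2 * c))⁻¹ ^ Module.finrank ℝ Vᗮ := by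
  let P := stdOrthonormalBasis ℝ V
  let Q := stdOrthonormalBasis ℝ Vᗮ
  let b := (P.prod Q).map V.orthogonalDecomposition.symm
  have hl : ∀ j, b (Sum.inl j) = P j := fun j => by simp [b]
  have hr : ∀ j, b (Sum.inr j) = Q j := fun j => by simp [b]
  have hcoord : ∀ (x : Fin (Module.finrank ℝ V) ⊕ Fin (Module.finrank ℝ Vᗮ) → ℝ) j,
      inner ℝ (b j) (∑ i, x i • b i) = x j := fun x j => b.orthonormal.inner_right_fintype x j
  have hexp : ∀ x : Fin (Module.finrank ℝ V) ⊕ Fin (Module.finrank ℝ Vᗮ) → ℝ,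
      Real.exp (a * ‖V.starProjection (∑ i, x i • b i)‖ ^ 2 +
        c * ‖Vᗮ.starProjection (∑ i, x i • b i)‖ ^ 2) =
      ∏ i, Real.exp ((Sum.elim (fun _ => a) (fun _ => c) i : ℝ) * x i ^ 2) := by
    intro x
    rw [← sum_inner_sq_eq_norm_sq_starProjection P, ← sum_inner_sq_eq_norm_sq_starProjection Q]
    simp_rw [← hl, ← hr, hcoord]
    rw [← Real.exp_sum, Fintype.sum_sum_type]
    simp [Finset.mul_sum]
  have hlt : ∀ i : Fin (Module.finrank ℝ V) ⊕ Fin (Module.finrank ℝ Vᗮ),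
      (Sum.elim (fun _ => a) (fun _ => c) i : ℝ) < 1 / 2 := by
    rintro (i | i)
    · exact ha
    · exact hc
  have hcont : Continuous fun x : E =>
      Real.exp (a * ‖V.starProjection x‖ ^ 2 + c * ‖Vᗮ.starProjection x‖ ^ 2) := by fun_prop
  have hmeas : Measurable fun x : Fin (Module.finrank ℝ V) ⊕ Fin (Module.finrank ℝ Vᗮ) → ℝ =>
      ∑ i, x i • b i := by fun_prop
  rw [stdGaussian_eq_map_pi_orthonormalBasis b]
  constructor
  · rw [integrable_map_measure hcont.aestronglyMeasurable hmeas.aemeasurable]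
    refine (Integrable.fintype_prod (f := fun i y =>
      Real.exp ((Sum.elim (fun _ => a) (fun _ => c) i : ℝ) * y ^ 2))
      fun i => integrable_exp_mul_sq_gaussianReal (hlt i)).congr (.of_forall fun x => ?_)
    exact (hexp x).symm
  · rw [integral_map hmeas.aemeasurable hcont.aestronglyMeasurable]
    simp_rw [hexp]
    rw [integral_fintype_prod_eq_prod (f := fun i y =>
      Real.exp ((Sum.elim (fun _ => a) (fun _ => c) i : ℝ) * y ^ 2))]
    simp_rw [integral_exp_mul_sq_gaussianReal (hlt _)]
    simp [Fintype.prod_sum_type, mul_comm]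

/-- The Chernoff bound of Dasgupta and Gupta for the share of the squared norm of a standard
Gaussian vector that lies in a subspace of dimension `k`: it bounds the probability that this share
is at least `β` times its mean `k / d` if `1 ≤ β`, and at most `β k / d` if `β ≤ 1`. -/
theorem measureReal_stdGaussian_starProjection_le (V : Submodule ℝ E) {β : ℝ} (hβ : 0 < β)
    (hV : Module.finrank ℝ V < Module.finrank ℝ E)
    (hβV : Module.finrank ℝ V * β < Module.finrank ℝ E) :
    (stdGaussian E).real {x | 0 ≤ (β - 1) * (Module.finrank ℝ E * ‖V.starProjection x‖ ^ 2 -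
        Module.finrank ℝ V * β * ‖x‖ ^ 2)} ≤
      Real.exp (Module.finrank ℝ V / 2 * (1 - β + Real.log β)) := by
  have hsum := V.finrank_add_finrank_orthogonal
  obtain ⟨k, hk⟩ : ∃ k, k = Module.finrank ℝ V := ⟨_, rfl⟩
  obtain ⟨l, hl⟩ : ∃ l, l = Module.finrank ℝ Vᗮ := ⟨_, rfl⟩
  rw [← hk, ← hl] at hsum
  rw [← hk, ← hsum] at hβV hV ⊢
  have hl0 : (0 : ℝ) < l := by exact_mod_cast (by omega : 0 < l)
  push_cast at hβV ⊢
  have hq : 0 < (k : ℝ) + l - k * β := by linarith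
  -- The exponents at which the exponential moment is smallest.
  obtain ⟨a, ha⟩ : ∃ a, a = (1 - 1 / β) / 2 := ⟨_, rfl⟩
  obtain ⟨c, hc⟩ : ∃ c, c = (1 - l / (k + l - k * β)) / 2 := ⟨_, rfl⟩
  have ha1 : 1 - 2 * a = 1 / β := by rw [ha]; ring
  have hc1 : 1 - 2 * c = l / (k + l - k * β) := by rw [hc]; ring
  have ha2 : a < 1 / 2 := by
    have : 0 < 1 / β := by positivity
    linarith
  have hc2 : c < 1 / 2 := by
    have : 0 < (l : ℝ) / (k + l - k * β) := by positivity
    linarith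
  obtain ⟨hint, hval⟩ := integral_exp_norm_sq_starProjection V ha2 hc2
  rw [ha1, hc1, ← hk, ← hl] at hval
  have hmarkov := mul_meas_ge_le_integral_of_nonneg
    (.of_forall fun x : E => (Real.exp_pos
      (a * ‖V.starProjection x‖ ^ 2 + c * ‖Vᗮ.starProjection x‖ ^ 2)).le) hint 1
  rw [one_mul, hval] at hmarkov
  refine (measureReal_mono fun x hx => ?_).trans (hmarkov.trans ?_)
  · have hx' : 0 ≤ (β - 1) * (((k : ℝ) + l) * ‖V.starProjection x‖ ^ 2 -
        k * β * ‖x‖ ^ 2) := hx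
    rw [V.norm_sq_eq_add_norm_sq_starProjection x] at hx'
    refine Real.one_le_exp ?_
    have h1 : a * ‖V.starProjection x‖ ^ 2 + c * ‖Vᗮ.starProjection x‖ ^ 2 =
        (2 * β * (k + l - k * β))⁻¹ * ((β - 1) * (((k : ℝ) + l) * ‖V.starProjection x‖ ^ 2 -
          k * β * (‖V.starProjection x‖ ^ 2 + ‖Vᗮ.starProjection x‖ ^ 2))) := by
      have hq' := hq.ne'
      rw [ha, hc]
      generalize hD : (k : ℝ) + l - k * β = D at hq' ⊢
      have hl' : (l : ℝ) = D + k * β - k := by linarith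
      rw [hl']
      field_simp
      ring
    rw [h1]
    positivity
  · have h1 : (√(1 / β))⁻¹ = Real.exp (Real.log β / 2) := by
      rw [one_div, Real.sqrt_inv, inv_inv, Real.exp_half, Real.exp_log hβ]
    have h2 : (√(l / (k + l - k * β)))⁻¹ ≤ Real.exp (-(k * (β - 1) / l) / 2) := by
      rw [← Real.sqrt_inv, inv_div, Real.exp_half]
      refine Real.sqrt_le_sqrt ?_
      have h3 := Real.add_one_le_exp (-(k * (β - 1) / l))
      refine le_trans (le_of_eq ?_) h3
      field_simp
      ring
    calc (√(1 / β))⁻¹ ^ k * (√(l / (k + l - k * β)))⁻¹ ^ l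
        ≤ Real.exp (Real.log β / 2) ^ k * Real.exp (-(k * (β - 1) / l) / 2) ^ l := by
          rw [h1]
          gcongr
      _ = Real.exp (k / 2 * (1 - β + Real.log β)) := by
          rw [← Real.exp_nat_mul, ← Real.exp_nat_mul, ← Real.exp_add]
          congr 1
          field_simp
          ring

end Gaussian

/-! ### Spans of independent standard Gaussian vectors -/

section RandomSubspace

variable {E : Type*} [NormedAddCommGroup E] [InnerProductSpace ℝ E]

theorem norm_starProjection_map_apply (V : Submodule ℝ E) [V.HasOrthogonalProjection]
    (O : E ≃ₗᵢ[ℝ] E) [(V.map (O.toLinearEquiv : E →ₗ[ℝ] E)).HasOrthogonalProjection] (y : E) :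
    ‖(V.map (O.toLinearEquiv : E →ₗ[ℝ] E)).starProjection (O y)‖ = ‖V.starProjection y‖ := by
  rw [Submodule.starProjection_map_apply, O.symm_apply_apply, O.norm_map]

variable [FiniteDimensional ℝ E]

/-- No linear independence is needed here: a vanishing Gram-Schmidt vector contributes `0`. -/
theorem starProjection_span_range_eq_sum {n : ℕ} (f : Fin n → E) (y : E) :
    (Submodule.span ℝ (Set.range f)).starProjection y =
      ∑ i, (Submodule.span ℝ {InnerProductSpace.gramSchmidt ℝ f i}).starProjection y := by
  obtain ⟨g, hg⟩ : ∃ g, g = InnerProductSpace.gramSchmidt ℝ f := ⟨_, rfl⟩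
  have hspan : Submodule.span ℝ (Set.range f) = Submodule.span ℝ (Set.range g) := by
    rw [hg, InnerProductSpace.span_gramSchmidt]
  have horth : ∀ i j, i ≠ j → inner ℝ (g i) (g j) = 0 := fun i j hij =>
    hg ▸ InnerProductSpace.gramSchmidt_orthogonal ℝ f hij
  rw [← hg]
  refine Submodule.eq_starProjection_of_mem_orthogonal ?_ ?_
  · rw [hspan]
    refine Submodule.sum_mem _ fun i _ => ?_
    have h1 : Submodule.span ℝ {g i} ≤ Submodule.span ℝ (Set.range g) :=
      Submodule.span_mono (by rintro _ rfl; exact ⟨i, rfl⟩)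
    exact h1 (Submodule.starProjection_apply_mem _ _)
  · rw [hspan]
    have h1 : Submodule.span ℝ (Set.range g) ≤ (Submodule.span ℝ
        {y - ∑ i, (Submodule.span ℝ {g i}).starProjection y})ᗮ := by
      rw [Submodule.span_le]
      rintro _ ⟨i, rfl⟩
      refine Submodule.mem_orthogonal_singleton_iff_inner_left.2 ?_
      rw [inner_sub_right, inner_sum, Finset.sum_eq_single i, ← inner_sub_right]
      · exact (Submodule.mem_orthogonal _ _).1 (Submodule.sub_starProjection_mem_orthogonal y) _
          (Submodule.mem_span_singleton_self _)
      · intro j _ hj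
        rw [Submodule.starProjection_singleton, real_inner_smul_right, horth i j hj.symm, mul_zero]
      · simp
    exact Submodule.le_orthogonal_iff_le_orthogonal.1 h1 (Submodule.mem_span_singleton_self _)

variable [MeasurableSpace E] [BorelSpace E]

theorem measurable_starProjection_singleton {α : Type*} [MeasurableSpace α] {g h : α → E}
    (hg : Measurable g) (hh : Measurable h) :
    Measurable fun x => (Submodule.span ℝ {g x}).starProjection (h x) := by
  simp_rw [Submodule.starProjection_singleton]
  exact ((hg.inner hh).div ((hg.norm).pow_const 2)).smul hg

theorem measurable_gramSchmidt {n : ℕ} (i : Fin n) :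
    Measurable fun f : Fin n → E => InnerProductSpace.gramSchmidt ℝ f i := by
  induction i using WellFoundedLT.induction with
  | ind i ih =>
    simp_rw [InnerProductSpace.gramSchmidt_def ℝ _ i]
    refine (measurable_pi_apply i).sub (Finset.measurable_sum _ fun j hj => ?_)
    exact measurable_starProjection_singleton (ih j (Finset.mem_Iio.1 hj)) (measurable_pi_apply i)

/-- The orthogonal projection of a vector onto the span of finitely many vectors is a measurable
function of all of them, linearly dependent families included. -/
theorem measurable_starProjection_span_range {α : Type*} [MeasurableSpace α] {n : ℕ}
    {f : α → Fin n → E} {h : α → E} (hf : Measurable f) (hh : Measurable h) :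
    Measurable fun x => (Submodule.span ℝ (Set.range (f x))).starProjection (h x) := by
  simp_rw [starProjection_span_range_eq_sum]
  exact Finset.measurable_sum _ fun i _ =>
    measurable_starProjection_singleton ((measurable_gramSchmidt i).comp hf) hh

theorem stdGaussian_submodule_eq_zero {V : Submodule ℝ E} (hV : V ≠ ⊤) :
    stdGaussian E V = 0 := by
  obtain ⟨u, hu, hu0⟩ := Submodule.exists_mem_ne_zero_of_ne_bot
    (fun h => hV (Submodule.orthogonal_eq_bot_iff.1 h))
  have h1 := IsGaussian.map_eq_gaussianReal (μ := stdGaussian E) (innerSL ℝ u)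
  rw [variance_dual_stdGaussian] at h1
  have h2 : (‖innerSL ℝ u‖ ^ 2).toNNReal ≠ 0 := by
    rw [ne_eq, Real.toNNReal_eq_zero, not_le, innerSL_apply_norm]
    positivity
  have h3 : (stdGaussian E).map (innerSL ℝ u) {0} = 0 := by
    rw [h1]
    have := nullSingletonClass_gaussianReal (μ := (stdGaussian E)[innerSL ℝ u]) h2
    exact measure_singleton 0
  rw [Measure.map_apply (by fun_prop) (measurableSet_singleton 0)] at h3
  refine measure_mono_null (fun x hx => ?_) h3
  exact (Submodule.mem_orthogonal' _ _).1 hu x hx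

/-- Given the vectors other than the first, the first one almost surely avoids their span, a proper
subspace. -/
theorem ae_linearIndependent_pi_stdGaussian :
    ∀ n : ℕ, n ≤ Module.finrank ℝ E →
      ∀ᵐ f ∂(Measure.pi fun _ : Fin n => stdGaussian E), LinearIndependent ℝ f
  | 0, _ => .of_forall fun f => linearIndependent_empty_type
  | n + 1, hn => by
    have ih := ae_linearIndependent_pi_stdGaussian n (by omega)
    have hmp := measurePreserving_piFinSuccAbove (fun _ : Fin (n + 1) => stdGaussian E) 0
    have hcont : Continuous fun p : E × (Fin n → E) => (Fin.cons p.1 p.2 : Fin (n + 1) → E) :=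
      continuous_pi fun i => by
        refine Fin.cases ?_ (fun j => ?_) i
        · simpa using continuous_fst
        · simpa [Function.comp_def] using (continuous_apply j).comp continuous_snd
    have hmeas : MeasurableSet {p : E × (Fin n → E) |
        ¬ LinearIndependent ℝ (Fin.cons p.1 p.2 : Fin (n + 1) → E)} :=
      ((isOpen_setOfPred_linearIndependent (𝕜 := ℝ)).preimage hcont).measurableSet.compl
    have key : ∀ᵐ p ∂((stdGaussian E).prod (Measure.pi fun _ : Fin n => stdGaussian E)),
        LinearIndependent ℝ (Fin.cons p.1 p.2 : Fin (n + 1) → E) := by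
      rw [ae_iff, Measure.prod_apply_symm hmeas, lintegral_eq_zero_iff
        (measurable_measure_prodMk_right hmeas)]
      filter_upwards [ih] with v hv
      have hne : Submodule.span ℝ (Set.range v) ≠ ⊤ := by
        intro h
        have h1 := finrank_span_eq_card hv
        rw [h, finrank_top, Fintype.card_fin] at h1
        omega
      refine measure_mono_null (fun z hz => ?_) (stdGaussian_submodule_eq_zero hne)
      by_contra hz'
      exact hz (linearIndependent_finCons.2 ⟨hv, hz'⟩)
    filter_upwards [hmp.quasiMeasurePreserving.ae key] with f hf
    have h1 : (Fin.cons (MeasurableEquiv.piFinSuccAbove (fun _ => E) 0 f).1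
        (MeasurableEquiv.piFinSuccAbove (fun _ => E) 0 f).2 : Fin (n + 1) → E) = f := by
      funext i
      refine Fin.cases ?_ (fun j => ?_) i <;>
        simp [MeasurableEquiv.piFinSuccAbove, Fin.insertNthEquiv, Fin.tail]
    rwa [h1] at hf

/-- If the law of a random configuration is invariant under rotations, then a scale-invariant
relation `R` between the configuration and a fixed nonzero vector is no more likely than the
relation between the configuration and an independent standard Gaussian vector. -/
theorem measure_le_of_rotation_invariant {α : Type*} [MeasurableSpace α] {μ : Measure α}
    [IsProbabilityMeasure μ] {R : α → E → Prop} (hR : MeasurableSet {p : α × E | R p.1 p.2})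
    (hrot : ∀ O : E ≃ₗᵢ[ℝ] E, ∃ T : α → α, MeasurePreserving T μ μ ∧
      ∀ x y, R (T x) (O y) ↔ R x y)
    (hscale : ∀ x y (r : ℝ), R x y → R x (r • y)) {C : ENNReal}
    (hC : ∀ᵐ x ∂μ, stdGaussian E {y | R x y} ≤ C) {e : E} (he : e ≠ 0) :
    μ {x | R x e} ≤ C := by
  -- A rescaled `e` is carried to an arbitrary vector `y` by a reflection.
  have h1 : ∀ y : E, μ {x | R x e} ≤ μ ((fun x => (x, y)) ⁻¹' {p : α × E | R p.1 p.2}) := by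
    intro y
    have hnorm : ‖(‖y‖ / ‖e‖) • e‖ = ‖y‖ := by
      rw [norm_smul, norm_div, norm_norm, norm_norm,
        div_mul_cancel₀ _ (norm_ne_zero_iff.2 he)]
    obtain ⟨T, hT, hTR⟩ := hrot (Submodule.span ℝ {(‖y‖ / ‖e‖) • e - y})ᗮ.reflection
    have hms : MeasurableSet ((fun x => (x, y)) ⁻¹' {p : α × E | R p.1 p.2}) :=
      measurable_prodMk_right hR
    rw [← hT.measure_preimage hms.nullMeasurableSet]
    refine measure_mono fun x hx => ?_
    have h2 := (hTR x ((‖y‖ / ‖e‖) • e)).2 (hscale x e _ hx)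
    rwa [Submodule.reflection_sub hnorm] at h2
  calc μ {x | R x e} = ∫⁻ _, μ {x | R x e} ∂(stdGaussian E) := by simp
    _ ≤ ∫⁻ y, μ ((fun x => (x, y)) ⁻¹' {p : α × E | R p.1 p.2}) ∂(stdGaussian E) :=
        lintegral_mono h1
    _ = ∫⁻ x, stdGaussian E (Prod.mk x ⁻¹' {p : α × E | R p.1 p.2}) ∂μ := by
        rw [← Measure.prod_apply_symm hR, Measure.prod_apply hR]
    _ ≤ ∫⁻ _, C ∂μ := lintegral_mono_ae hC
    _ = C := by simp

/-- Tail bound for the share of a fixed vector that lies in a random subspace `V x` of dimension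
`k` whose law is invariant under rotations (cf. `measureReal_stdGaussian_starProjection_le`). If
`1 ≤ β` it is enough that `V x` is contained in a subspace of dimension `k`. -/
theorem measure_starProjection_le_of_rotation_invariant {α : Type*} [MeasurableSpace α]
    {μ : Measure α} [IsProbabilityMeasure μ] {V : α → Submodule ℝ E}
    (hV : Measurable fun p : α × E => (V p.1).starProjection p.2)
    (hrot : ∀ O : E ≃ₗᵢ[ℝ] E, ∃ T : α → α, MeasurePreserving T μ μ ∧
      ∀ x, V (T x) = (V x).map (O.toLinearEquiv : E →ₗ[ℝ] E))
    {k : ℕ} {β : ℝ} (hβ : 0 < β) (hk : k < Module.finrank ℝ E)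
    (hβk : k * β < Module.finrank ℝ E)
    (hdim : ∀ᵐ x ∂μ, ∃ L : Submodule ℝ E, Module.finrank ℝ L = k ∧ V x ≤ L ∧ (β < 1 → V x = L))
    {e : E} (he : e ≠ 0) :
    μ {x | 0 ≤ (β - 1) * (Module.finrank ℝ E * ‖(V x).starProjection e‖ ^ 2 -
        k * β * ‖e‖ ^ 2)} ≤
      ENNReal.ofReal (Real.exp (k / 2 * (1 - β + Real.log β))) := by
  refine measure_le_of_rotation_invariant (R := fun x y =>
    0 ≤ (β - 1) * (Module.finrank ℝ E * ‖(V x).starProjection y‖ ^ 2 - k * β * ‖y‖ ^ 2))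
    ?_ ?_ ?_ ?_ he
  · exact measurableSet_le measurable_const (((((hV.norm).pow_const 2).const_mul _).sub
      (((measurable_snd.norm).pow_const 2).const_mul _)).const_mul _)
  · intro O
    obtain ⟨T, hT, hTV⟩ := hrot O
    refine ⟨T, hT, fun x y => ?_⟩
    simp only [hTV, norm_starProjection_map_apply, O.norm_map]
  · intro x y r h
    rw [map_smul, norm_smul, norm_smul, mul_pow, mul_pow]
    have h1 := mul_nonneg (sq_nonneg ‖r‖) h
    refine h1.trans (le_of_eq ?_)
    ring
  · filter_upwards [hdim] with x hx
    obtain ⟨L, rfl, hVL, hL⟩ := hx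
    rw [← ENNReal.toReal_le_toReal (measure_ne_top _ _) ENNReal.ofReal_ne_top,
      ENNReal.toReal_ofReal (Real.exp_pos _).le]
    refine le_trans (measureReal_mono fun y hy => ?_)
      (measureReal_stdGaussian_starProjection_le L hβ hk hβk)
    rcases lt_or_ge β 1 with h1 | h1
    · rw [← hL h1]
      rw [← hL h1] at hy
      exact hy
    · have h2 : ‖(V x).starProjection y‖ ≤ ‖L.starProjection y‖ := by
        have h3 : (V x).starProjection (L.starProjection y) = (V x).starProjection y :=
          congrArg Subtype.val (Submodule.orthogonalProjectionOnto_starProjection_of_le hVL y)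
        rw [← h3]
        exact (V x).norm_starProjection_apply_le _
      have hy' : 0 ≤ (β - 1) * (Module.finrank ℝ E * ‖(V x).starProjection y‖ ^ 2 -
        Module.finrank ℝ L * β * ‖y‖ ^ 2) := hy
      refine hy'.trans ?_
      have : 0 ≤ β - 1 := by linarith
      gcongr

end RandomSubspace

/-! ### Gaussian interventions -/

section GaussianInterventions

variable {d n : ℕ}

/-- The span of the Gaussian covariate shifts. In a configuration `x`, the shift of environment
`m ≠ 0` is `x m`, and `x 0` is the vector projected to obtain the target shift. -/
noncomputable def shiftSpan (x : Fin (n + 1) → Vec d) : Submodule ℝ (Vec d) :=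
  Submodule.span ℝ (Set.range fun i : Fin n => x i.succ)

/-- The line spanned by the difference between the covariate shift of environment `m` and that of
the target. -/
noncomputable def gapSpan (m : Fin (n + 1)) (x : Fin (n + 1) → Vec d) : Submodule ℝ (Vec d) :=
  Submodule.span ℝ {(if m = 0 then 0 else x m) - (shiftSpan x).starProjection (x 0)}

theorem measurePreserving_rotate (O : Vec d ≃ₗᵢ[ℝ] Vec d) :
    MeasurePreserving (fun (x : Fin (n + 1) → Vec d) i => O (x i))
      (Measure.pi fun _ => stdGaussian (Vec d)) (Measure.pi fun _ => stdGaussian (Vec d)) :=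
  measurePreserving_pi _ _ fun _ => ⟨O.continuous.measurable, stdGaussian_map O⟩

theorem shiftSpan_rotate (O : Vec d ≃ₗᵢ[ℝ] Vec d) (x : Fin (n + 1) → Vec d) :
    shiftSpan (fun i => O (x i)) =
      (shiftSpan x).map (O.toLinearEquiv : Vec d →ₗ[ℝ] Vec d) := by
  rw [shiftSpan, shiftSpan, Submodule.map_span, ← Set.range_comp]
  rfl

theorem gapSpan_rotate (m : Fin (n + 1)) (O : Vec d ≃ₗᵢ[ℝ] Vec d) (x : Fin (n + 1) → Vec d) :
    gapSpan m (fun i => O (x i)) = (gapSpan m x).map (O.toLinearEquiv : Vec d →ₗ[ℝ] Vec d) := by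
  rw [gapSpan, gapSpan, Submodule.map_span, Set.image_singleton]
  simp only [shiftSpan_rotate, Submodule.starProjection_map_apply, O.symm_apply_apply]
  congr 2
  split_ifs <;> simp

theorem measurable_starProjection_shiftSpan {α : Type*} [MeasurableSpace α]
    {f : α → Fin (n + 1) → Vec d} {h : α → Vec d} (hf : Measurable f) (hh : Measurable h) :
    Measurable fun x => (shiftSpan (f x)).starProjection (h x) :=
  measurable_starProjection_span_range
    (measurable_pi_lambda _ fun i => (measurable_pi_apply i.succ).comp hf) hh

theorem measurable_starProjection_gapSpan (m : Fin (n + 1)) :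
    Measurable fun p : (Fin (n + 1) → Vec d) × Vec d => (gapSpan m p.1).starProjection p.2 := by
  refine measurable_starProjection_singleton (Measurable.sub ?_ ?_) measurable_snd
  · split_ifs
    · exact measurable_const
    · exact (measurable_pi_apply m).comp measurable_fst
  · exact measurable_starProjection_shiftSpan measurable_fst
      ((measurable_pi_apply 0).comp measurable_fst)

theorem ae_finrank_shiftSpan (hn : n + 1 ≤ d) :
    ∀ᵐ x ∂(Measure.pi fun _ : Fin (n + 1) => stdGaussian (Vec d)),
      Module.finrank ℝ (shiftSpan x) = n := by
  filter_upwards [ae_linearIndependent_pi_stdGaussian (E := Vec d) (n + 1) (by simpa)] with x hx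
  have h1 : LinearIndependent ℝ fun i : Fin n => x i.succ :=
    hx.comp _ (Fin.succ_injective n)
  rw [shiftSpan, finrank_span_eq_card h1, Fintype.card_fin]

/-- Tail bound for the share of `b` in the span of the Gaussian covariate shifts. -/
theorem measure_shiftSpan_le (hn : n + 1 ≤ d) {β : ℝ} (hβ : 0 < β) (hβn : n * β < d) {b : Vec d}
    (hb : b ≠ 0) :
    (Measure.pi fun _ : Fin (n + 1) => stdGaussian (Vec d))
        {x | 0 ≤ (β - 1) * (d * ‖(shiftSpan x).starProjection b‖ ^ 2 - n * β * ‖b‖ ^ 2)} ≤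
      ENNReal.ofReal (Real.exp (n / 2 * (1 - β + Real.log β))) := by
  have h := measure_starProjection_le_of_rotation_invariant (E := Vec d)
    (μ := Measure.pi fun _ : Fin (n + 1) => stdGaussian (Vec d)) (V := shiftSpan) (k := n)
    (β := β) (measurable_starProjection_shiftSpan measurable_fst measurable_snd)
    (fun O => ⟨_, measurePreserving_rotate O, shiftSpan_rotate O⟩) hβ (by simpa using hn)
    (by simpa using hβn)
    ((ae_finrank_shiftSpan hn).mono fun x hx => ⟨shiftSpan x, hx, le_rfl, fun _ => rfl⟩) hb
  simpa only [finrank_euclideanSpace_fin] using h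

/-- Tail bound for the squared inner product of `b` with the direction of the difference between the
covariate shift of environment `m` and that of the target. -/
theorem measure_gapSpan_le (hd : 1 < d) (m : Fin (n + 1)) {β : ℝ} (hβ : 1 ≤ β) (hβd : β < d)
    {b : Vec d} (hb : b ≠ 0) :
    (Measure.pi fun _ : Fin (n + 1) => stdGaussian (Vec d))
        {x | 0 ≤ (β - 1) * (d * ‖(gapSpan m x).starProjection b‖ ^ 2 - β * ‖b‖ ^ 2)} ≤
      ENNReal.ofReal (Real.exp (1 / 2 * (1 - β + Real.log β))) := by
  have h := measure_starProjection_le_of_rotation_invariant (E := Vec d)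
    (μ := Measure.pi fun _ : Fin (n + 1) => stdGaussian (Vec d)) (V := gapSpan m) (k := 1)
    (β := β) (measurable_starProjection_gapSpan m)
    (fun O => ⟨_, measurePreserving_rotate O, gapSpan_rotate m O⟩) (by linarith)
    (by simpa using hd) (by simpa using hβd)
    (.of_forall fun x => ?_) hb
  · simpa only [finrank_euclideanSpace_fin, Nat.cast_one, one_mul] using h
  · by_cases h0 : (if m = 0 then 0 else x m) - (shiftSpan x).starProjection (x 0) = 0
    · -- A vanishing gap spans no line; any line contains its span.
      refine ⟨Submodule.span ℝ {b}, finrank_span_singleton hb, ?_, fun h => by linarith⟩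
      rw [gapSpan, h0]
      simp
    · exact ⟨gapSpan m x, finrank_span_singleton h0, le_rfl, fun _ => rfl⟩

end GaussianInterventions

/-- Neither `S` nor the preimage of a measurable set under the almost everywhere measurable `T` has
to be measurable; measurable hulls of both give the event. -/
theorem exists_measurableSet_of_map_eq {Ω α : Type*} [MeasurableSpace Ω] [MeasurableSpace α]
    {ν : Measure Ω} [IsProbabilityMeasure ν] {μ : Measure α} {T : Ω → α} (hT : AEMeasurable T ν)
    (hμ : ν.map T = μ) {S : Set α} {q : ℝ} (hq : 0 ≤ q) (hS : μ S ≤ ENNReal.ofReal q) :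
    ∃ A : Set Ω, MeasurableSet A ∧ ENNReal.ofReal (1 - q) ≤ ν A ∧ ∀ ω ∈ A, T ω ∉ S := by
  refine ⟨(toMeasurable ν (T ⁻¹' toMeasurable μ S))ᶜ, (measurableSet_toMeasurable _ _).compl, ?_,
    fun ω hω h => hω (subset_toMeasurable _ _ (subset_toMeasurable _ _ h))⟩
  rw [prob_compl_eq_one_sub (measurableSet_toMeasurable _ _), measure_toMeasurable,
    ← Measure.map_apply_of_aemeasurable hT (measurableSet_toMeasurable _ _), hμ,
    measure_toMeasurable, ENNReal.ofReal_sub _ hq, ENNReal.ofReal_one]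
  exact tsub_le_tsub_left hS 1

/-- The sum of the Chernoff bounds for the three bad events (share of `b` in the shift span too
large or too small, share along the gap direction too large). When both factors `1 - α` and `1 - β` on the
right are positive, `n` and `c` are large enough for the sum to be at most `(α + β) / 2`, which is
at most `1 - (1 - α) * (1 - β)`; a union bound over the bad events thus gives the product. -/
theorem chernoff_sum_le {n d : ℕ} {c : ℝ}
    (h1 : 0 < 1 - 2 * Real.exp (-(d / 32 : ℝ)) - 2 * Real.exp (-((n + 1 : ℕ) / 32 : ℝ)))
    (h2 : 0 < 1 - Real.exp (-(c / 16)) - 2 * Real.exp (-(c / 4))) :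
    5 ≤ c ∧
    Real.exp (n / 2 * (1 - 3 + Real.log 3)) + Real.exp (n / 2 * (1 - 1 / 3 + Real.log (1 / 3))) +
        Real.exp (1 / 2 * (1 - c + Real.log c)) ≤
      1 - (1 - 2 * Real.exp (-(d / 32 : ℝ)) - 2 * Real.exp (-((n + 1 : ℕ) / 32 : ℝ))) *
        (1 - Real.exp (-(c / 16)) - 2 * Real.exp (-(c / 4))) := by
  have hlog2 := Real.log_two_gt_d9
  have hlog2' := Real.log_two_lt_d9
  have hhalf : Real.exp (-Real.log 2) = 1 / 2 := by
    rw [Real.exp_neg, Real.exp_log (by norm_num), one_div]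
  have hlog3 : Real.log 3 ≤ 1.2 := by
    have h3 : Real.log 3 = Real.log 2 + Real.log (3 / 2) := by
      rw [← Real.log_mul (by norm_num) (by norm_num)]
      norm_num
    have h4 := Real.log_le_sub_one_of_pos (show (0 : ℝ) < 3 / 2 by norm_num)
    linarith
  have hlog3' : 1 ≤ Real.log 3 := by
    rw [Real.le_log_iff_exp_le (by norm_num)]
    linarith [Real.exp_one_lt_d9]
  have hd0 := Real.exp_pos (-(d / 32 : ℝ))
  have hn0 := Real.exp_pos (-((n + 1 : ℕ) / 32 : ℝ))
  have hc0 := Real.exp_pos (-(c / 16))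
  have hc0' := Real.exp_pos (-(c / 4))
  have hn : (22 : ℝ) ≤ n := by
    -- Otherwise `2 * exp (-(n + 1) / 32)` is at least `1`, because `22 / 32 < log 2`.
    by_contra! hlt
    have hlt' : n + 1 ≤ 22 := by
      have : n < 22 := by exact_mod_cast hlt
      omega
    have h3 : ((n + 1 : ℕ) : ℝ) ≤ 22 := by exact_mod_cast hlt'
    have h4 : Real.exp (-Real.log 2) ≤ Real.exp (-((n + 1 : ℕ) / 32 : ℝ)) :=
      Real.exp_le_exp.2 (by linarith)
    linarith
  have hc : 5 ≤ c := by
    by_contra! hlt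
    have h3 : (11 / 16 : ℝ) ≤ Real.exp (-(c / 16)) := by
      have := Real.add_one_le_exp (-(c / 16))
      linarith
    have h4 : Real.exp (-(c / 4)) = Real.exp (-(c / 16)) ^ 4 := by
      rw [← Real.exp_nat_mul]
      congr 1
      push_cast
      ring
    have h5 : (11 / 16 : ℝ) ^ 4 ≤ Real.exp (-(c / 16)) ^ 4 := by gcongr
    rw [← h4] at h5
    norm_num at h5
    linarith
  refine ⟨hc, ?_⟩
  have hq1 : Real.exp (n / 2 * (1 - 3 + Real.log 3)) ≤
      1 / 2 * Real.exp (-((n + 1 : ℕ) / 32 : ℝ)) := by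
    rw [← hhalf, ← Real.exp_add]
    refine Real.exp_le_exp.2 ?_
    push_cast
    nlinarith
  have hq2 : Real.exp (n / 2 * (1 - 1 / 3 + Real.log (1 / 3))) ≤
      1 / 2 * Real.exp (-((n + 1 : ℕ) / 32 : ℝ)) := by
    rw [← hhalf, ← Real.exp_add, one_div, Real.log_inv]
    refine Real.exp_le_exp.2 ?_
    push_cast
    nlinarith
  have hq3 : Real.exp (1 / 2 * (1 - c + Real.log c)) ≤ 1 / 2 * Real.exp (-(c / 16)) := by
    have h5 : 1 / 2 * Real.exp (-(c / 16)) = Real.exp (-Real.log 2 + -(c / 16)) := by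
      rw [Real.exp_add, hhalf]
    rw [h5]
    refine Real.exp_le_exp.2 ?_
    have h3 : Real.log c = Real.log 3 + Real.log (c / 3) := by
      rw [← Real.log_mul (by norm_num) (by positivity)]
      congr 1
      ring
    have h4 := Real.log_le_sub_one_of_pos (show 0 < c / 3 by positivity)
    linarith
  nlinarith [mul_pos (show 0 < 2 * Real.exp (-(d / 32 : ℝ)) +
    2 * Real.exp (-((n + 1 : ℕ) / 32 : ℝ)) by positivity) h2,
    mul_pos (show 0 < Real.exp (-(c / 16)) + 2 * Real.exp (-(c / 4)) by positivity) h1]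

/-- A likely event on which the span of the Gaussian covariate shifts has dimension `n`, the share
of `‖b‖²` in it is within a factor `3` of its mean `n / d`, and the share of `‖b‖²` along the gap
direction is at most `c / d`. -/
theorem exists_measurableSet_shiftSpan {d n : ℕ} {b : Vec d} (hb : b ≠ 0) (hd : 6 * (n + 1) ≤ d)
    {c : ℝ} (hcd : c ≤ d / 2) (m : Fin (n + 1)) {Ω : Type*} [MeasurableSpace Ω]
    {ν : Measure Ω} [IsProbabilityMeasure ν] {T : Ω → Fin (n + 1) → Vec d}
    (hT : HasLaw T (Measure.pi fun _ => stdGaussian (Vec d)) ν) :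
    ∃ A : Set Ω, MeasurableSet A ∧
      ENNReal.ofReal (1 - 2 * Real.exp (-(d / 32 : ℝ)) -
          2 * Real.exp (-((n + 1 : ℕ) / 32 : ℝ))) *
        ENNReal.ofReal (1 - Real.exp (-(c / 16)) - 2 * Real.exp (-(c / 4))) ≤ ν A ∧
      ∀ ω ∈ A, Module.finrank ℝ (shiftSpan (T ω)) = n ∧
        d * ‖(shiftSpan (T ω)).starProjection b‖ ^ 2 ≤ 3 * n * ‖b‖ ^ 2 ∧
        n * ‖b‖ ^ 2 ≤ 3 * d * ‖(shiftSpan (T ω)).starProjection b‖ ^ 2 ∧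
        d * ‖(gapSpan m (T ω)).starProjection b‖ ^ 2 ≤ c * ‖b‖ ^ 2 := by
  -- If one of the two factors vanishes, the empty event will do.
  rcases le_or_gt (1 - 2 * Real.exp (-(d / 32 : ℝ)) - 2 * Real.exp (-((n + 1 : ℕ) / 32 : ℝ))) 0
    with h1 | h1
  · exact ⟨∅, MeasurableSet.empty, by rw [ENNReal.ofReal_of_nonpos h1]; simp, by simp⟩
  rcases le_or_gt (1 - Real.exp (-(c / 16)) - 2 * Real.exp (-(c / 4))) 0 with h2 | h2
  · exact ⟨∅, MeasurableSet.empty, by rw [ENNReal.ofReal_of_nonpos h2]; simp, by simp⟩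
  obtain ⟨hc, hsum⟩ := chernoff_sum_le h1 h2
  have hd' : (6 : ℝ) * (n + 1) ≤ d := by exact_mod_cast hd
  have hn0 : (0 : ℝ) ≤ n := Nat.cast_nonneg n
  have t1 := measure_shiftSpan_le (n := n) (d := d) (β := 3) (by omega) (by norm_num)
    (by linarith) hb
  have t2 := measure_shiftSpan_le (n := n) (d := d) (β := 1 / 3) (by omega) (by norm_num)
    (by linarith) hb
  have t3 := measure_gapSpan_le (n := n) (d := d) (by omega) m (β := c) (by linarith)
    (by linarith) hb
  have t4 := ae_iff.1 (ae_finrank_shiftSpan (n := n) (d := d) (by omega))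
  have hS := (measure_union_le _ _).trans (add_le_add ((measure_union_le _ _).trans (add_le_add
    ((measure_union_le _ _).trans (add_le_add t1 t2)) t3)) t4.le)
  rw [add_zero, ← ENNReal.ofReal_add (by positivity) (by positivity),
    ← ENNReal.ofReal_add (by positivity) (by positivity)] at hS
  obtain ⟨A, hA, hνA, hAS⟩ := exists_measurableSet_of_map_eq hT.aemeasurable hT.map_eq
    (by positivity) hS
  refine ⟨A, hA, le_trans ?_ hνA, fun ω hω => ?_⟩
  · rw [← ENNReal.ofReal_mul h1.le]
    exact ENNReal.ofReal_le_ofReal (by linarith)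
  · have h3 := hAS ω hω
    simp only [Set.mem_union, Set.mem_ofPred_eq, not_or, not_not, not_le] at h3
    obtain ⟨⟨⟨h4, h5⟩, h6⟩, h7⟩ := h3
    refine ⟨h7, ?_, ?_, ?_⟩
    · linarith
    · linarith
    · have h8 := neg_of_mul_neg_right h6 (by linarith)
      linarith

end AnticausalDA

theorem mainTheorem10 {d M : ℕ} [NeZero M] (hM : 2 ≤ M)
    (B : Matrix (Fin d) (Fin d) ℝ) (hB : IsUnit (1 - B)) (b : Vec d)
    (σ ρ : ℝ) (hσ : 0 < σ) (hρ : 0 < ρ)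
    (noise : Measure (Vec d × ℝ))
    (hnoise : IsNoise noise ((σ ^ 2 / ρ) • (1 : Matrix (Fin d) (Fin d) ℝ)) σ)
    (aY : Fin M → ℝ) (aYt : ℝ) :
    -- exact risks for fixed interventions
    (∀ (aX : Fin M → Vec d) (aXt : Vec d) (E : Model d M), E = ⟨B, b, noise, aX, aY, aXt, aYt⟩ →
      aXt - aX 0 ∈ E.interventionSpan →
      b ∉ E.interventionSpan →
      (∀ (p : ℕ) (P₄ : OrthonormalBasis (Fin p) ℝ E.interventionSpan),
        E.HasTargetRisk E.IsRII
          (σ ^ 2 / (ρ * ‖b‖ ^ 2 - ρ * ∑ j, (inner ℝ (P₄ j : Vec d) b) ^ 2))) ∧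
      ∀ m : Fin M,
        E.HasTargetRisk (E.IsRIIRMI m) (σ ^ 2 / (ρ * ‖b‖ ^ 2 - ρ * (inner ℝ (E.u m) b) ^ 2)) ∧
        (LabelComparable noise aY →
          E.HasTargetRisk (E.IsCIRMI m)
            (σ ^ 2 / (ρ * ‖b‖ ^ 2 - ρ * (inner ℝ (E.u m) b) ^ 2)))) ∧
    -- high-probability bounds for Gaussian interventions
    (∀ (Ω : Type u) [MeasurableSpace Ω] (ν : Measure Ω) [IsProbabilityMeasure ν]
      (aX : Ω → Fin M → Vec d) (aXt ξ : Ω → Vec d) (E : Ω → Model d M),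
      (∀ ω, E ω = ⟨B, b, noise, aX ω, aY, aXt ω, aYt⟩) →
      (∀ m : Fin M, m ≠ 0 → HasLaw (fun ω => aX ω m - aX ω 0) (stdGaussian (Vec d)) ν) →
      HasLaw ξ (stdGaussian (Vec d)) ν →
      iIndepFun (fun (m : Fin M) (ω : Ω) => if m = 0 then ξ ω else aX ω m - aX ω 0) ν →
      (∀ ω, aXt ω - aX ω 0 = (E ω).interventionSpan.starProjection (ξ ω)) →
      b ≠ 0 → 6 * M ≤ d →
      ∀ (c : ℝ), 0 < c → c ≤ d / 2 → ∀ m : Fin M,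
        ∃ A : Set Ω, MeasurableSet A ∧
          ENNReal.ofReal (1 - 2 * Real.exp (-(d / 32 : ℝ)) - 2 * Real.exp (-(M / 32 : ℝ))) *
              ENNReal.ofReal (1 - Real.exp (-(c / 16)) - 2 * Real.exp (-(c / 4))) ≤ ν A ∧
          ∀ ω ∈ A,
            Module.finrank ℝ (E ω).interventionSpan = M - 1 ∧
            (∃ r, (E ω).HasTargetRisk (E ω).IsRII r ∧
              σ ^ 2 / (ρ * (1 - ((M : ℝ) - 1) / (3 * d)) * ‖b‖ ^ 2) ≤ r ∧
              r ≤ σ ^ 2 / (ρ * (1 - 3 * ((M : ℝ) - 1) / d) * ‖b‖ ^ 2)) ∧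
            ∃ r, (E ω).HasTargetRisk ((E ω).IsRIIRMI m) r ∧
              (LabelComparable noise aY → (E ω).HasTargetRisk ((E ω).IsCIRMI m) r) ∧
              r ≤ σ ^ 2 / (ρ * (1 - c / d) * ‖b‖ ^ 2)) := by
  constructor
  · intro aX aXt E hE ht hb
    have hB' : IsUnit (1 - E.B) := by rw [hE]; exact hB
    have hn : IsNoise E.noise ((σ ^ 2 / ρ) • (1 : Matrix (Fin d) (Fin d) ℝ)) σ := by
      rw [hE]; exact hnoise
    have hEb : E.b = b := by rw [hE]
    have ht' : E.aXt - E.aX 0 ∈ E.interventionSpan := by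
      have h1 : E.aXt - E.aX 0 = aXt - aX 0 := by rw [hE]
      rwa [h1]
    rw [← hEb] at hb ⊢
    refine ⟨fun p P₄ => ?_, fun m => ⟨?_, fun hc => ?_⟩⟩
    · rw [sum_inner_sq_eq_norm_sq_starProjection, ← mul_sub]
      exact Model.hasTargetRisk_isRII hM hB' hσ hρ hn ht' hb
    · exact Model.hasTargetRisk_isRIIRMI hM hB' hσ hρ hn ht' hb m
    · have hc' : LabelComparable E.noise E.aY := by rw [hE]; exact hc
      exact Model.hasTargetRisk_isCIRMI hB' hσ hρ hn hc' ht' hb m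
  · intro Ω _ ν _ aX aXt ξ E hE hZ hξ hind ht hb hd c hc0 hcd m
    obtain ⟨n, rfl⟩ : ∃ n, M = n + 1 := ⟨M - 1, by omega⟩
    -- The configuration of the shifts and of `ξ`, which carries index `0`, is i.i.d. Gaussian.
    obtain ⟨T, hTdef⟩ : ∃ T : Ω → Fin (n + 1) → Vec d,
      T = fun ω m => if m = 0 then ξ ω else aX ω m - aX ω 0 := ⟨_, rfl⟩
    have hlaw : ∀ m : Fin (n + 1), HasLaw (fun ω => if m = 0 then ξ ω else aX ω m - aX ω 0)
        (stdGaussian (Vec d)) ν := by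
      intro m
      by_cases hm : m = 0
      · simpa only [hm, if_true] using hξ
      · simpa only [hm, if_false] using hZ m hm
    have hT : HasLaw T (Measure.pi fun _ => stdGaussian (Vec d)) ν := by
      rw [hTdef]
      refine ⟨aemeasurable_pi_lambda _ fun m => (hlaw m).aemeasurable, ?_⟩
      rw [hind.map_fun_eq_pi_map fun m => (hlaw m).aemeasurable]
      simp only [(hlaw _).map_eq]
    obtain ⟨A, hA, hνA, hgood⟩ := exists_measurableSet_shiftSpan hb hd hcd m hT
    refine ⟨A, hA, hνA, fun ω hω => ?_⟩
    obtain ⟨g1, g2, g3, g4⟩ := hgood ω hω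
    have hspan : (E ω).interventionSpan = shiftSpan (T ω) := by
      have h1 : ∀ i : Fin n, T ω i.succ = aX ω i.succ - aX ω 0 := fun i => by
        rw [hTdef]
        exact if_neg (Fin.succ_ne_zero i)
      rw [Model.interventionSpan, shiftSpan, hE ω]
      apply le_antisymm
      · rw [Submodule.span_le]
        rintro _ ⟨i, rfl⟩
        refine Fin.cases ?_ (fun j => ?_) i
        · change aX ω 0 - aX ω 0 ∈ Submodule.span ℝ _
          rw [sub_self]
          exact Submodule.zero_mem _
        · exact Submodule.subset_span ⟨j, h1 j⟩
      · rw [Submodule.span_le]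
        rintro _ ⟨i, rfl⟩
        exact Submodule.subset_span ⟨i.succ, (h1 i).symm⟩
    have hgap : gapSpan m (T ω) = Submodule.span ℝ {(E ω).aX m - (E ω).aXt} := by
      have h1 : T ω 0 = ξ ω := by rw [hTdef]; exact if_pos rfl
      have h2 : (if m = 0 then 0 else T ω m) = aX ω m - aX ω 0 := by
        by_cases hm : m = 0
        · simp [hm]
        · simp [hTdef, hm]
      have h3 : (shiftSpan (T ω)).starProjection (T ω 0) = aXt ω - aX ω 0 := by
        rw [ht, h1]
        simp only [hspan]
      rw [gapSpan, h3, h2, hE ω, sub_sub_sub_cancel_right]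
    have hB' : IsUnit (1 - (E ω).B) := by rw [hE]; exact hB
    have hn : IsNoise (E ω).noise ((σ ^ 2 / ρ) • (1 : Matrix (Fin d) (Fin d) ℝ)) σ := by
      rw [hE]; exact hnoise
    have hEb : (E ω).b = b := by rw [hE]
    have ht' : (E ω).aXt - (E ω).aX 0 ∈ (E ω).interventionSpan := by
      have h1 : (E ω).aXt - (E ω).aX 0 = aXt ω - aX ω 0 := by rw [hE]
      rw [h1, ht]
      exact Submodule.starProjection_apply_mem _ _
    simp only [← hspan] at g1 g2 g3
    rw [hgap, Model.norm_sq_starProjection_span_sub] at g4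
    rw [← hEb] at hb g2 g3 g4 ⊢
    have hd' : (6 : ℝ) * (n + 1) ≤ d := by exact_mod_cast hd
    have hn0 : (0 : ℝ) ≤ n := Nat.cast_nonneg n
    have hd0 : (0 : ℝ) < d := by linarith
    have hbb : 0 < ‖(E ω).b‖ ^ 2 := by positivity
    have hbV : (E ω).b ∉ (E ω).interventionSpan := by
      intro h
      rw [Submodule.starProjection_eq_self_iff.2 h] at g2
      nlinarith
    have hM1 : ((n + 1 : ℕ) : ℝ) - 1 = n := by push_cast; ring
    refine ⟨by rw [hspan, g1, Nat.add_sub_cancel],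
      ⟨_, Model.hasTargetRisk_isRII hM hB' hσ hρ hn ht' hbV, ?_, ?_⟩,
      ⟨_, Model.hasTargetRisk_isRIIRMI hM hB' hσ hρ hn ht' hbV m, fun hc => ?_, ?_⟩⟩
    · rw [hM1, mul_assoc]
      have h1 : n / (3 * d) * ‖(E ω).b‖ ^ 2 ≤
          ‖(E ω).interventionSpan.starProjection (E ω).b‖ ^ 2 := by
        rw [div_mul_eq_mul_div, div_le_iff₀ (by positivity)]
        linarith
      have h2 : ‖(E ω).interventionSpan.starProjection (E ω).b‖ ^ 2 < ‖(E ω).b‖ ^ 2 := by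
        nlinarith
      refine div_le_div_of_nonneg_left (by positivity) (mul_pos hρ (by linarith)) ?_
      exact mul_le_mul_of_nonneg_left (by linarith) hρ.le
    · rw [hM1, mul_assoc]
      have h1 : ‖(E ω).interventionSpan.starProjection (E ω).b‖ ^ 2 ≤
          3 * n / d * ‖(E ω).b‖ ^ 2 := by
        rw [div_mul_eq_mul_div, le_div_iff₀ hd0]
        linarith
      have h2 : 3 * n / d < (1 : ℝ) := by
        rw [div_lt_one hd0]
        linarith
      refine div_le_div_of_nonneg_left (by positivity)
        (mul_pos hρ (mul_pos (by linarith) hbb)) ?_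
      exact mul_le_mul_of_nonneg_left (by linarith) hρ.le
    · have hc' : LabelComparable (E ω).noise (E ω).aY := by rw [hE]; exact hc
      exact Model.hasTargetRisk_isCIRMI hB' hσ hρ hn hc' ht' hbV m
    · rw [← mul_sub, mul_assoc]
      have h1 : (inner ℝ ((E ω).u m) (E ω).b) ^ 2 ≤ c / d * ‖(E ω).b‖ ^ 2 := by
        rw [div_mul_eq_mul_div, le_div_iff₀ hd0]
        linarith
      have h2 : c / d < 1 := by
        rw [div_lt_one hd0]
        linarith
      refine div_le_div_of_nonneg_left (by positivity)
        (mul_pos hρ (mul_pos (by linarith) hbb)) ?_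
      exact mul_le_mul_of_nonneg_left (by linarith) hρ.le
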